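/- Let $0<\nu<1$, and put $w=\tfrac12$, $\mu=\tfrac{1-\nu}{2}$. For $L\ge 2$ consider diffusion-limited pair annihilation and deposition on the torus $\mathbb T_L=\mathbb Z/L\mathbb Z$ together with its activity: the continuous-time Markov chain on $\{0,1\}^{\mathbb T_L}\times\mathbb N_0$ with generator $$(\tilde{\mathcal H}f)(\eta,A)=\sum_{k=0}^{L-1}\Big[\mu f(\bar\eta^{\,k,k+1},A)+w(\eta_k+\eta_{k+1})f(\bar\eta^{\,k,k+1},A+1)-\big(\mu+w(\eta_k+\eta_{k+1})\big)f(\eta,A)\Big],$$ where $\bar\eta^{\,k,k+1}$ is $\eta$ with the occupation numbers at the sites $k$ and $k+1$ replaced by $1-\eta_k$ and $1-\eta_{k+1}$. Write $\langle\cdot\rangle_{\eta,0}$ for the expectation of the chain started in $(\eta,0)$, and $A(t)$ for the activity at time $t$. Then for every $L\ge 2$ and every $s\in\mathbb R$ the limit $$K_L(s)=\lim_{t\to\infty}\frac{1}{Lt}\ln\big\langle e^{sA(t)}\big\rangle_{\eta,0}$$ exists and is the same for all $\eta$ with an even number of particles, and $K_L$ is three times continuously differentiable near the critical point $s_c=\ln(1-\mu/w)=\ln\nu$.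 Let $\kappa^c_n(L)=K_L^{(n)}(s_c)$ for $n=2,3$ be the critical cumulants in the even sector, and let $S^c(L)=\kappa^c_3(L)/(\kappa^c_2(L))^{3/2}$ be the critical skewness. As $L\to\infty$, $$\kappa^c_3(L)\sim\frac34\,\frac{\nu^2(2-\nu)}{(1-\nu^2)^{3/2}\,\pi}\,\ln L ,$$ and the critical skewness tends to $0$, with $$S^c(L)\sim\frac{3(2-\nu)}{\nu(1-\nu^2)^{3/4}}\sqrt{\frac{\pi}{2\ln L}} .$$ Here $a_L\sim b_L$ means that $a_L/b_L\to1$. -/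

import Mathlib

open Filter Topology Asymptotics

noncomputable section

namespace DLPAD

/-- Configurations on the integer torus with `L` sites: `true` means that the site is occupied. -/
abbrev Config (L : ℕ) : Type := ZMod L → Bool

/-- The occupation number at site `k`, as a real number. -/
def occ {L : ℕ} (η : Config L) (k : ZMod L) : ℝ := ((η k).toNat : ℝ)

/-- The configuration flipped at the two sites `k` and `k + 1`. -/
def flip {L : ℕ} (η : Config L) (k : ZMod L) : Config L :=
  fun j => if j = k ∨ j = k + 1 then !(η j) else η j

/-- The even sector: configurations with an even number of particles. -/
def IsEven {L : ℕ} (η : Config L) : Prop :=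
  Even (∑ k ∈ Finset.range L, (η (k : ZMod L)).toNat)

/-- The generator of the joint process (configuration, activity). On each bond `(k, k + 1)` a
deposition event of rate `μ` flips the bond and keeps the activity, and a particle jump, of rate
`w * (η k + η (k + 1))`, flips the bond and raises the activity by one. -/
def jointGenerator (w μ : ℝ) (L : ℕ) (f : Config L × ℕ → ℝ) : Config L × ℕ → ℝ :=
  fun x => ∑ k ∈ Finset.range L,
    (μ * f (flip x.1 (k : ZMod L), x.2)
      + w * (occ x.1 (k : ZMod L) + occ x.1 ((k : ZMod L) + 1))
          * f (flip x.1 (k : ZMod L), x.2 + 1)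
      - (μ + w * (occ x.1 (k : ZMod L) + occ x.1 ((k : ZMod L) + 1))) * f x)

/-- The Markov semigroup `exp (t * jointGenerator)` of the joint process. The jump rates are bounded,
so that the exponential series converges absolutely on bounded functions `f`, and its value at `x`
is the expectation of `f` at time `t` for the process started in `x`. -/
def semigroup (w μ : ℝ) (L : ℕ) (t : ℝ) (f : Config L × ℕ → ℝ) (x : Config L × ℕ) : ℝ :=
  ∑' m : ℕ, t ^ m / (m.factorial : ℝ) * ((jointGenerator w μ L)^[m] f) x

/-- The probability that the activity at time `t` equals `n`, for the joint process started in
configuration `η` with activity `0`. -/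
def activityProb (w μ : ℝ) (L : ℕ) (η : Config L) (t : ℝ) (n : ℕ) : ℝ :=
  semigroup w μ L t (fun x => if x.2 = n then 1 else 0) (η, 0)

/-- The moment generating function of the activity at time `t`, started in `η`. -/
def activityMGF (w μ : ℝ) (L : ℕ) (η : Config L) (s t : ℝ) : ℝ :=
  ∑' n : ℕ, activityProb w μ L η t n * Real.exp (s * n)

/-- The cumulant generating function of the activity per site and unit of time. -/
def scaledCGF (w μ : ℝ) (L : ℕ) (η : Config L) (s t : ℝ) : ℝ :=
  Real.log (activityMGF w μ L η s t) / (L * t)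

/-- The limiting cumulant generating function in the even sector: the long-time limit of
`scaledCGF`, started in the empty configuration. -/
def limitingCGF (w μ : ℝ) (L : ℕ) (s : ℝ) : ℝ :=
  limUnder atTop (fun t : ℝ => scaledCGF w μ L (fun _ => false) s t)

/-- The limiting cumulant generating function with `w = 1/2` and `μ = (1 - ν) / 2`. -/
def cgf (ν : ℝ) (L : ℕ) (s : ℝ) : ℝ := limitingCGF (1 / 2) ((1 - ν) / 2) L s

/-- The critical value `log (1 - μ / w)` of the Legendre parameter, for `w = 1/2` and
`μ = (1 - ν) / 2`. -/
def sCrit (ν : ℝ) : ℝ := Real.log (1 - ((1 - ν) / 2) / (1 / 2))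

/-- The `n`-th critical cumulant. -/
def criticalCumulant (ν : ℝ) (n L : ℕ) : ℝ := iteratedDeriv n (cgf ν L) (sCrit ν)

/-- The critical skewness. -/
def criticalSkewness (ν : ℝ) (L : ℕ) : ℝ :=
  criticalCumulant ν 3 L / (criticalCumulant ν 2 L) ^ (3 / 2 : ℝ)

end DLPAD

end

/-! The moment generating function of the activity is `exp (t T)` applied to the constant `1`, where
`T` is the generator on configurations tilted by `x = exp s` per jump (`activityMGF_eq`). So
everything reduces to the growth rate of a finite-dimensional semigroup.

The bond flips become quadratic in fermions after a Jordan–Wigner transformation. In the even sector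
the fermions are antiperiodic, and Fourier modes at `q = (2m+1)π/L` decouple `T` into pairs `(q,
-q)` (`tiltedGeneratorC_eq`). A product of paired excitations over the vacuum is an eigenvector as
soon as its amplitudes solve a quadratic equation per pair (`mode_eigen`,
`tiltedGeneratorC_topVector`). Its eigenvalue is `-(μ+w)L` plus half the sum of the square roots of
the mode discriminants.

That this eigenvalue governs the growth is a Perron–Frobenius argument. At `s = 0` the eigenvector
is harmonic, hence positive by the minimum principle. A nonnegative eigenvector that does not vanish
at the empty configuration is strictly positive on even configurations. Positivity is therefore an
open and closed condition in `s`, so it holds for all `s` (`re_topVector_pos`). Comparing `1` with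
multiples of a positive eigenvector gives the limit from every even start (`tendsto_scaledCGF`).

At `s_c` each discriminant is `4σ²` times a positive smooth function of `σ = sin (q/2)`, and its
first derivative is also of order `σ²`, while the higher ones stay of order one. The second and
third derivatives of the square root are thus both `Ψ(σ)/σ` with `Ψ` smooth
(`criticalCumulant_eq_sum`), and the mean of `Ψ(σ)/σ` over modes, halved, grows like `Ψ(0) ln L / π`
(`tendsto_sum_div_sin`). Both cumulants are of order `ln L`, so the skewness is of order `(ln
L)^(-1/2)`. -/

namespace DLPAD

/-! ### Jordan–Wigner fermions and the bond flips. -/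

section JordanWigner

variable {L : ℕ}

/-- The configuration with the occupation of the single site `j` changed. -/
def flipSite (j : ℕ) (η : Config L) : Config L := Function.update η (j : ZMod L) (!η (j : ZMod L))

/-- The sign `-1` of an occupied site. -/
def siteSign (j : ℕ) (η : Config L) : ℂ := if η (j : ZMod L) then -1 else 1

/-- The Jordan–Wigner string: the parity of the number of particles at the sites before `j`. -/
def stringSign (j : ℕ) (η : Config L) : ℂ := ∏ i ∈ Finset.range j, siteSign i η

/-- The lattice fermions: `fermion j true` creates and `fermion j false` annihilates a particle
at the site `j`. -/
def fermion (j : ℕ) (b : Bool) : Module.End ℂ (Config L → ℂ) where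
  toFun f η := if η (j : ZMod L) = b then stringSign j η * f (flipSite j η) else 0
  map_add' f g := by ext η; by_cases h : η (j : ZMod L) = b <;> simp [h, mul_add]
  map_smul' r f := by ext η; by_cases h : η (j : ZMod L) = b <;> simp [h, mul_left_comm]

theorem fermion_apply (j : ℕ) (b : Bool) (f : Config L → ℂ) (η : Config L) :
    fermion j b f η = if η (j : ZMod L) = b then stringSign j η * f (flipSite j η) else 0 := rfl

theorem siteSign_mul_self (j : ℕ) (η : Config L) : siteSign j η * siteSign j η = 1 := by
  unfold siteSign; split_ifs <;> norm_num

theorem stringSign_mul_self (j : ℕ) (η : Config L) : stringSign j η * stringSign j η = 1 := by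
  rw [stringSign, ← Finset.prod_mul_distrib]
  exact Finset.prod_eq_one fun i _ => siteSign_mul_self i η

theorem flipSite_self_apply (j : ℕ) (η : Config L) :
    flipSite j η (j : ZMod L) = !η (j : ZMod L) := by simp [flipSite]

theorem flipSite_flipSite (j : ℕ) (η : Config L) : flipSite j (flipSite j η) = η := by
  simp [flipSite]

theorem cast_ne_cast {i j : ℕ} (hi : i < L) (hj : j < L) (hij : i ≠ j) :
    (i : ZMod L) ≠ (j : ZMod L) := by
  intro h
  rw [ZMod.natCast_eq_natCast_iff'] at h
  rw [Nat.mod_eq_of_lt hi, Nat.mod_eq_of_lt hj] at h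
  exact hij h

theorem flipSite_apply_of_ne {i j : ℕ} (hi : i < L) (hj : j < L) (hij : i ≠ j) (η : Config L) :
    flipSite i η (j : ZMod L) = η (j : ZMod L) := by
  simp [flipSite, Function.update_of_ne (cast_ne_cast hj hi hij.symm)]

theorem flipSite_comm {i j : ℕ} (hi : i < L) (hj : j < L) (hij : i ≠ j) (η : Config L) :
    flipSite i (flipSite j η) = flipSite j (flipSite i η) := by
  have h1 := flipSite_apply_of_ne hi hj hij η
  have h2 := flipSite_apply_of_ne hj hi hij.symm η
  rw [flipSite, h2, flipSite, flipSite, h1, flipSite,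
    Function.update_comm (cast_ne_cast hj hi hij.symm)]

theorem siteSign_flipSite_self (j : ℕ) (η : Config L) :
    siteSign j (flipSite j η) = -siteSign j η := by
  rw [siteSign, siteSign, flipSite_self_apply]
  cases η (j : ZMod L) <;> simp

theorem siteSign_flipSite_of_ne {i j : ℕ} (hi : i < L) (hj : j < L) (hij : i ≠ j) (η : Config L) :
    siteSign j (flipSite i η) = siteSign j η := by
  rw [siteSign, siteSign, flipSite_apply_of_ne hi hj hij]

theorem stringSign_flipSite_of_le {i j : ℕ} (hi : i < L) (hji : j ≤ i) (η : Config L) :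
    stringSign j (flipSite i η) = stringSign j η := by
  refine Finset.prod_congr rfl fun k hk => ?_
  have hk := Finset.mem_range.1 hk
  exact siteSign_flipSite_of_ne hi (by omega) (by omega) η

theorem stringSign_flipSite_of_lt {i j : ℕ} (hj : j ≤ L) (hij : i < j) (η : Config L) :
    stringSign j (flipSite i η) = -stringSign j η := by
  have hm : i ∈ Finset.range j := Finset.mem_range.2 hij
  rw [stringSign, stringSign, ← Finset.mul_prod_erase _ _ hm, ← Finset.mul_prod_erase _ _ hm,
    siteSign_flipSite_self, neg_mul]
  congr 2
  refine Finset.prod_congr rfl fun k hk => ?_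
  have hk1 := Finset.ne_of_mem_erase hk
  have hk2 := Finset.mem_range.1 (Finset.mem_of_mem_erase hk)
  exact siteSign_flipSite_of_ne (by omega) (by omega) hk1.symm η

theorem stringSign_succ (j : ℕ) (η : Config L) :
    stringSign (j + 1) η = stringSign j η * siteSign j η := Finset.prod_range_succ _ _

/-- The string of the later site `j` contains `i`, while the string of `i` does not contain `j`:
exchanging the operators changes exactly one sign. -/
theorem fermion_anticomm_of_lt {i j : ℕ} (hij : i < j) (hj : j < L) (b b' : Bool) :
    (fermion i b : Module.End ℂ (Config L → ℂ)) * fermion j b' =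
      -(fermion j b' * fermion i b) := by
  ext f η
  have hi : i < L := hij.trans hj
  simp only [Module.End.mul_apply, LinearMap.neg_apply, Pi.neg_apply, fermion_apply,
    flipSite_apply_of_ne hi hj hij.ne, flipSite_apply_of_ne hj hi hij.ne',
    stringSign_flipSite_of_le hj hij.le, stringSign_flipSite_of_lt hj.le hij,
    flipSite_comm hj hi hij.ne']
  split_ifs <;> (simp; try ring)

theorem fermion_anticomm {i j : ℕ} (hi : i < L) (hj : j < L) (hij : i ≠ j) (b b' : Bool) :
    (fermion i b : Module.End ℂ (Config L → ℂ)) * fermion j b' =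
      -(fermion j b' * fermion i b) := by
  rcases lt_or_gt_of_ne hij with h | h
  · exact fermion_anticomm_of_lt h hj b b'
  · rw [fermion_anticomm_of_lt h hi b' b, neg_neg]

theorem fermion_mul_self (j : ℕ) (b : Bool) :
    (fermion j b : Module.End ℂ (Config L → ℂ)) * fermion j b = 0 := by
  ext f η
  simp only [Module.End.mul_apply, fermion_apply, flipSite_self_apply]
  split_ifs with h1 h2 <;> simp_all

theorem fermion_same_anticomm (b : Bool) {i j : ℕ} (hi : i < L) (hj : j < L) :
    (fermion i b : Module.End ℂ (Config L → ℂ)) * fermion j b =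
      -(fermion j b * fermion i b) := by
  rcases eq_or_ne i j with rfl | h
  · simp [fermion_mul_self]
  · exact fermion_anticomm hi hj h b b

theorem annihilate_mul_create {i j : ℕ} (hi : i < L) (hj : j < L) :
    (fermion i false : Module.End ℂ (Config L → ℂ)) * fermion j true =
      (if i = j then 1 else 0) - fermion j true * fermion i false := by
  rcases eq_or_ne i j with rfl | h
  · rw [if_pos rfl]
    ext f η
    simp only [Module.End.mul_apply, fermion_apply, flipSite_self_apply, LinearMap.sub_apply,
      Pi.sub_apply, stringSign_flipSite_of_le hi le_rfl, flipSite_flipSite, Module.End.one_apply]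
    have := stringSign_mul_self i η
    cases η (i : ZMod L) <;> simp [← mul_assoc, this]
  · rw [if_neg h, zero_sub]
    exact fermion_anticomm hi hj h _ _

/-- The functions that vanish outside the even sector. -/
def EvenSupported (f : Config L → ℂ) : Prop := ∀ η : Config L, stringSign L η * f η = f η

theorem EvenSupported.add {f g : Config L → ℂ} (hf : EvenSupported f) (hg : EvenSupported g) :
    EvenSupported (f + g) := fun η => by
  rw [Pi.add_apply, mul_add, hf η, hg η]

theorem EvenSupported.smul {f : Config L → ℂ} (hf : EvenSupported f) (r : ℂ) :
    EvenSupported (r • f) := fun η => by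
  rw [Pi.smul_apply, smul_eq_mul, mul_left_comm, hf η]

theorem stringSign_mul_fermion {j : ℕ} (hj : j < L) (b : Bool) (f : Config L → ℂ) (η : Config L) :
    stringSign L η * fermion j b f η = -fermion j b (fun ζ => stringSign L ζ * f ζ) η := by
  simp only [fermion_apply, stringSign_flipSite_of_lt le_rfl hj]
  split_ifs <;> (simp; try ring)

theorem stringSign_eq (j : ℕ) (η : Config L) :
    stringSign j η = (-1) ^ (∑ k ∈ Finset.range j, (η (k : ZMod L)).toNat) := by
  rw [stringSign, ← Finset.prod_pow_eq_pow_sum]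
  refine Finset.prod_congr rfl fun k _ => ?_
  unfold siteSign
  cases η (k : ZMod L) <;> simp

theorem isEven_iff (η : Config L) : IsEven η ↔ stringSign L η = 1 := by
  rw [stringSign_eq, IsEven, neg_one_pow_eq_one_iff_even (by norm_num)]

theorem flip_eq_of_lt {k : ℕ} (hk : k + 1 < L) (η : Config L) :
    flip η (k : ZMod L) = flipSite k (flipSite (k + 1) η) := by
  have hne := cast_ne_cast (by omega : k < L) hk (by omega : k ≠ k + 1)
  push_cast at hne
  ext j
  simp only [flip, flipSite, Function.update_apply, Nat.cast_add, Nat.cast_one]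
  by_cases h1 : j = (k : ZMod L)
  · subst h1
    simp [hne]
  · by_cases h2 : j = (k : ZMod L) + 1
    · subst h2
      simp [h1]
    · simp [h1, h2]

theorem flip_last {n : ℕ} (hL : L = n + 1) (hn : 0 < n) (η : Config L) :
    flip η (n : ZMod L) = flipSite n (flipSite 0 η) := by
  have hne := cast_ne_cast (by omega : n < L) (by omega : 0 < L) (by omega : n ≠ 0)
  have h0 : (n : ZMod L) + 1 = 0 := by
    subst hL
    exact_mod_cast ZMod.natCast_self (n + 1)
  push_cast at hne
  ext j
  simp only [flip, flipSite, Function.update_apply, h0, Nat.cast_zero]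
  by_cases h1 : j = (n : ZMod L)
  · subst h1
    simp [hne]
  · by_cases h2 : j = 0
    · subst h2
      simp [h1]
    · simp [h1, h2]

theorem stringSign_flip {k : ℕ} (hL : 2 ≤ L) (hk : k < L) (η : Config L) :
    stringSign L (flip η (k : ZMod L)) = stringSign L η := by
  rcases Nat.lt_or_ge (k + 1) L with h | h
  · rw [flip_eq_of_lt h, stringSign_flipSite_of_lt le_rfl hk, stringSign_flipSite_of_lt le_rfl h,
      neg_neg]
  · obtain rfl : L = k + 1 := by omega
    rw [flip_last rfl (by omega), stringSign_flipSite_of_lt le_rfl hk,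
      stringSign_flipSite_of_lt le_rfl (by omega), neg_neg]

theorem isEven_flip {k : ℕ} (hL : 2 ≤ L) (hk : k < L) {η : Config L} (hη : IsEven η) :
    IsEven (flip η (k : ZMod L)) := by
  rw [isEven_iff] at *
  rw [stringSign_flip hL hk, hη]

/-- The fermionic form of the jump over the bond between two sites with annihilators `c`, `c'` and
creators `d`, `d'`. -/
def bondOperator {A : Type*} [Ring A] [Algebra ℂ A] (α a μ : ℂ) (c d c' d' : A) : A :=
  a • (d * c' + d' * c) + α • (d * d') - μ • (c * c')

/-- The strings of neighbouring sites differ only by the sign of site `k`, so they cancel. The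
occupations 00, 01 or 10, and 11 select the weights `μ`, `μ + w x` and `μ + 2 w x`. -/
theorem bondOperator_apply_of_lt {k : ℕ} (hk : k + 1 < L) (w μ x : ℂ) (f : Config L → ℂ)
    (η : Config L) :
    bondOperator (μ + 2 * w * x) (μ + w * x) μ (fermion k false) (fermion k true)
      (fermion (k + 1) false) (fermion (k + 1) true) f η =
    (μ + w * x * (occ η k + occ η (k + 1))) * f (flip η (k : ZMod L)) := by
  have hk' : k < L := by omega
  have hc : ((k + 1 : ℕ) : ZMod L) = (k : ZMod L) + 1 := by push_cast; rfl
  have hs := stringSign_mul_self k η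
  have e1 := flipSite_apply_of_ne hk' hk (by omega) η
  have e2 := flipSite_apply_of_ne hk hk' (by omega) η
  rw [flip_eq_of_lt hk]
  simp only [bondOperator, LinearMap.sub_apply, LinearMap.add_apply, LinearMap.smul_apply,
    Pi.sub_apply, Pi.add_apply, Pi.smul_apply, smul_eq_mul, Module.End.mul_apply, fermion_apply,
    e1, e2, stringSign_flipSite_of_lt hk.le (Nat.lt_succ_self k),
    stringSign_flipSite_of_le hk (Nat.le_succ k),
    flipSite_comm hk hk' (by omega), stringSign_succ, occ, ← hc, siteSign]
  generalize f (flipSite k (flipSite (k + 1) η)) = F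
  rcases mul_self_eq_one_iff.1 hs with hs | hs <;>
    cases η (k : ZMod L) <;> cases η ((k + 1 : ℕ) : ZMod L) <;> simp [hs] <;>
    first | ring1 | (left; ring1)

/-- On the closing bond the string runs through the whole ring and becomes the total parity. In the
even sector this amounts to replacing the fermions at site `L` by minus those at site `0`. -/
theorem bondOperator_apply_last {n : ℕ} (hL : L = n + 1) (hn : 0 < n) (w μ x : ℂ)
    {f : Config L → ℂ} (hf : EvenSupported f) (η : Config L) :
    bondOperator (μ + 2 * w * x) (μ + w * x) μ (fermion n false) (fermion n true)
      (-fermion 0 false) (-fermion 0 true) f η =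
    (μ + w * x * (occ η n + occ η (n + 1))) * f (flip η (n : ZMod L)) := by
  have hn' : n < L := by omega
  have h0' : 0 < L := by omega
  have h0 : (n : ZMod L) + 1 = ((0 : ℕ) : ZMod L) := by
    subst hL
    exact_mod_cast ZMod.natCast_self (n + 1)
  have hs := stringSign_mul_self n η
  have e1 := flipSite_apply_of_ne hn' h0' (by omega) η
  have e2 := flipSite_apply_of_ne h0' hn' (by omega) η
  have hF := hf (flip η (n : ZMod L))
  rw [stringSign_flip (by omega) hn', flip_last hL hn] at hF
  have hLn : stringSign L η = stringSign n η * siteSign n η := by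
    subst hL
    exact stringSign_succ n η
  rw [hLn, siteSign] at hF
  rw [flip_last hL hn]
  simp only [bondOperator, LinearMap.sub_apply, LinearMap.add_apply, LinearMap.smul_apply,
    Pi.sub_apply, Pi.add_apply, Pi.smul_apply, smul_eq_mul, Module.End.mul_apply, fermion_apply,
    LinearMap.neg_apply, Pi.neg_apply,
    e1, e2, stringSign_flipSite_of_lt hn'.le hn, stringSign_flipSite_of_le hn' hn.le,
    flipSite_comm h0' hn' (by omega), occ, h0]
  have h00 : ∀ ζ : Config L, stringSign 0 ζ = 1 := fun ζ => Finset.prod_range_zero _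
  simp only [h00]
  revert hF
  generalize f (flipSite n (flipSite 0 η)) = F
  rcases mul_self_eq_one_iff.1 hs with hs | hs <;>
    cases η (n : ZMod L) <;> cases η ((0 : ℕ) : ZMod L) <;> simp [hs] <;> try intro hF
  -- If the parity of `η` is odd, `hF` says `-F = F`, and both sides vanish.
  all_goals first
    | (have hF0 : F = 0 := self_eq_neg.1 hF.symm
       simp [hF0])
    | ring1
    | (left; ring1)

end JordanWigner

/-! ### Antiperiodic Fourier modes. -/

section Fourier

/-- The antiperiodic momenta. -/
noncomputable def momentum (L m : ℕ) : ℝ := (2 * m + 1) * Real.pi / L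

/-- The phase factor of an antiperiodic momentum. -/
noncomputable def phase (L m : ℕ) : ℂ := Complex.exp (momentum L m * Complex.I)

theorem phase_eq {L : ℕ} (hL : L ≠ 0) (m : ℕ) :
    phase L m = Complex.exp (Real.pi / L * Complex.I) *
      Complex.exp (2 * Real.pi * Complex.I / L) ^ m := by
  have : (L : ℂ) ≠ 0 := Nat.cast_ne_zero.2 hL
  rw [phase, momentum, ← Complex.exp_nat_mul, ← Complex.exp_add]
  congr 1
  push_cast
  field_simp
  ring

theorem phase_pow_card {L : ℕ} (hL : L ≠ 0) (m : ℕ) : phase L m ^ L = -1 := by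
  have : (L : ℂ) ≠ 0 := Nat.cast_ne_zero.2 hL
  rw [phase, momentum, ← Complex.exp_nat_mul, ← Complex.exp_pi_mul_I]
  rw [Complex.exp_eq_exp_iff_exists_int]
  refine ⟨m, ?_⟩
  push_cast
  field_simp
  ring

theorem phase_mul_phase_reflect {L m : ℕ} (hm : m < L) :
    phase L m * phase L (L - 1 - m) = 1 := by
  have hL : (L : ℂ) ≠ 0 := Nat.cast_ne_zero.2 (by omega)
  rw [phase, phase, momentum, momentum, ← Complex.exp_add, ← Complex.exp_two_pi_mul_I]
  congr 1
  obtain ⟨k, rfl⟩ : ∃ k, L = m + 1 + k := ⟨L - 1 - m, by omega⟩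
  rw [show m + 1 + k - 1 - m = k by omega]
  push_cast at hL ⊢
  field_simp
  ring

theorem phase_reflect {L m : ℕ} (hm : m < L) : phase L (L - 1 - m) = (phase L m)⁻¹ :=
  eq_inv_of_mul_eq_one_right (phase_mul_phase_reflect hm)

theorem sum_root_pow {L i j : ℕ} (hi : i < L) (hj : j < L) :
    ∑ k ∈ Finset.range L, (Complex.exp (2 * Real.pi * Complex.I / L) ^ i *
      (Complex.exp (2 * Real.pi * Complex.I / L) ^ j)⁻¹) ^ k = if i = j then (L : ℂ) else 0 := by
  have hζ := Complex.isPrimitiveRoot_exp L (by omega)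
  set ζ := Complex.exp (2 * Real.pi * Complex.I / L)
  have hζ0 : ζ ≠ 0 := Complex.exp_ne_zero _
  split_ifs with h
  · subst h
    simp [hζ0]
  · have hne : ζ ^ i * (ζ ^ j)⁻¹ ≠ 1 := by
      intro h1
      rw [mul_inv_eq_one₀ (pow_ne_zero _ hζ0)] at h1
      exact h (hζ.pow_inj hi hj h1)
    have h1 : (ζ ^ i * (ζ ^ j)⁻¹) ^ L = 1 := by
      rw [mul_pow, inv_pow, ← pow_mul, ← pow_mul, mul_comm i, mul_comm j, pow_mul, pow_mul,
        hζ.pow_eq_one]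
      simp
    have h2 := mul_neg_geom_sum (ζ ^ i * (ζ ^ j)⁻¹) L
    rw [h1, sub_self, mul_eq_zero] at h2
    exact h2.resolve_left (sub_ne_zero.2 hne.symm)

theorem sum_phase_site {L m p : ℕ} (hm : m < L) (hp : p < L) :
    ∑ k ∈ Finset.range L, phase L m ^ k * (phase L p)⁻¹ ^ k = if m = p then (L : ℂ) else 0 := by
  rw [← sum_root_pow hm hp]
  refine Finset.sum_congr rfl fun k _ => ?_
  have := Complex.exp_ne_zero (Real.pi / L * Complex.I)
  rw [← mul_pow, phase_eq (by omega), phase_eq (by omega)]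
  congr 1
  field_simp

theorem sum_phase_mode {L j l : ℕ} (hj : j < L) (hl : l < L) :
    ∑ m ∈ Finset.range L, phase L m ^ j * (phase L m)⁻¹ ^ l = if j = l then (L : ℂ) else 0 := by
  have hξ := Complex.exp_ne_zero (Real.pi / L * Complex.I)
  have hζ := Complex.exp_ne_zero (2 * Real.pi * Complex.I / L)
  have : ∀ m, phase L m ^ j * (phase L m)⁻¹ ^ l =
      (Complex.exp (Real.pi / L * Complex.I) ^ j * (Complex.exp (Real.pi / L * Complex.I) ^ l)⁻¹) *
      (Complex.exp (2 * Real.pi * Complex.I / L) ^ j *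
      (Complex.exp (2 * Real.pi * Complex.I / L) ^ l)⁻¹) ^ m := by
    intro m
    rw [phase_eq (by omega), inv_pow, mul_pow, mul_pow, mul_pow, inv_pow, mul_inv, ← pow_mul,
      ← pow_mul, ← pow_mul, ← pow_mul, mul_comm m j, mul_comm m l]
    ring
  simp_rw [this]
  rw [← Finset.mul_sum, sum_root_pow hj hl]
  split_ifs with h
  · subst h
    field_simp
  · rw [mul_zero]

/-- A Parseval identity for operators: summing over sites keeps only the products of `m` with its
partner `τ m`. Here `τ` is the identity for hopping terms and the reflection `m ↦ L - 1 - m` for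
pair terms. -/
theorem sum_range_mul_of_orthogonal {A : Type*} [Ring A] [Algebra ℂ A] {L : ℕ} (X Y : ℕ → A)
    (x y : ℕ → ℂ) (τ : ℕ → ℕ) (hτ : ∀ m < L, τ m < L)
    (horth : ∀ m < L, ∀ p < L,
      ∑ k ∈ Finset.range L, x m ^ k * y p ^ k = if p = τ m then (L : ℂ) else 0) (i j : ℕ) :
    ∑ k ∈ Finset.range L, (∑ m ∈ Finset.range L, x m ^ (k + i) • X m) *
        (∑ p ∈ Finset.range L, y p ^ (k + j) • Y p) =
      ∑ m ∈ Finset.range L, (L * x m ^ i * y (τ m) ^ j) • (X m * Y (τ m)) := by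
  simp_rw [Finset.sum_mul_sum, smul_mul_smul_comm]
  rw [Finset.sum_comm]
  refine Finset.sum_congr rfl fun m hm => ?_
  rw [Finset.sum_comm]
  have hm := Finset.mem_range.1 hm
  rw [Finset.sum_eq_single (τ m)]
  · rw [← Finset.sum_smul]
    congr 1
    have := horth m hm (τ m) (hτ m hm)
    rw [if_pos rfl] at this
    rw [← this, Finset.sum_mul, Finset.sum_mul]
    refine Finset.sum_congr rfl fun k _ => ?_
    ring
  · intro p hp hne
    have := horth m hm p (Finset.mem_range.1 hp)
    rw [if_neg hne] at this
    rw [← Finset.sum_smul]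
    convert zero_smul ℂ _
    rw [show ∑ k ∈ Finset.range L, x m ^ (k + i) * y p ^ (k + j) =
      (∑ k ∈ Finset.range L, x m ^ k * y p ^ k) * (x m ^ i * y p ^ j) by
        rw [Finset.sum_mul]
        refine Finset.sum_congr rfl fun k _ => ?_
        ring, this, zero_mul]
  · intro h
    exact absurd (Finset.mem_range.2 (hτ m hm)) h

variable (L : ℕ)

/-- The annihilator of a momentum mode. -/
noncomputable def modeAnnihilate (m : ℕ) : Module.End ℂ (Config L → ℂ) :=
  (L : ℂ)⁻¹ • ∑ j ∈ Finset.range L, (phase L m)⁻¹ ^ j • fermion j false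

/-- The creator of a momentum mode. -/
noncomputable def modeCreate (m : ℕ) : Module.End ℂ (Config L → ℂ) :=
  ∑ j ∈ Finset.range L, phase L m ^ j • fermion j true

/-- The annihilation field, extended antiperiodically. -/
noncomputable def annihilationField (j : ℕ) : Module.End ℂ (Config L → ℂ) :=
  ∑ m ∈ Finset.range L, phase L m ^ j • modeAnnihilate L m

/-- The creation field, extended antiperiodically. -/
noncomputable def creationField (j : ℕ) : Module.End ℂ (Config L → ℂ) :=
  ∑ m ∈ Finset.range L, (phase L m)⁻¹ ^ j • ((L : ℂ)⁻¹ • modeCreate L m)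

variable {L}

theorem annihilationField_of_lt {j : ℕ} (hj : j < L) :
    annihilationField L j = fermion j false := by
  have hL : (L : ℂ) ≠ 0 := Nat.cast_ne_zero.2 (by omega)
  simp only [annihilationField, modeAnnihilate, Finset.smul_sum, smul_smul]
  rw [Finset.sum_comm]
  rw [Finset.sum_eq_single j]
  · rw [← Finset.sum_smul]
    have := sum_phase_mode hj hj
    rw [if_pos rfl] at this
    convert one_smul ℂ _
    rw [← inv_mul_cancel₀ hL]
    nth_rw 3 [← this]
    rw [Finset.mul_sum]
    refine Finset.sum_congr rfl fun m _ => ?_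
    ring
  · intro l hl hne
    have := sum_phase_mode hj (Finset.mem_range.1 hl)
    rw [if_neg hne.symm] at this
    rw [← Finset.sum_smul]
    convert zero_smul ℂ _
    rw [← mul_zero (L : ℂ)⁻¹, ← this, Finset.mul_sum]
    refine Finset.sum_congr rfl fun m _ => ?_
    ring
  · intro h
    exact absurd (Finset.mem_range.2 hj) h

/-- The momenta are chosen so that `phase ^ L = -1`, which is the sign required on the closing bond.
-/
theorem annihilationField_card (hL : L ≠ 0) : annihilationField L L = -fermion 0 false := by
  rw [← annihilationField_of_lt (by omega : 0 < L), annihilationField, annihilationField,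
    ← Finset.sum_neg_distrib]
  refine Finset.sum_congr rfl fun m _ => ?_
  rw [phase_pow_card hL, pow_zero, one_smul]
  module

theorem creationField_of_lt {j : ℕ} (hj : j < L) : creationField L j = fermion j true := by
  have hL : (L : ℂ) ≠ 0 := Nat.cast_ne_zero.2 (by omega)
  simp only [creationField, modeCreate, Finset.smul_sum, smul_smul]
  rw [Finset.sum_comm]
  rw [Finset.sum_eq_single j]
  · rw [← Finset.sum_smul]
    have := sum_phase_mode hj hj
    rw [if_pos rfl] at this
    convert one_smul ℂ _
    rw [← inv_mul_cancel₀ hL]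
    nth_rw 3 [← this]
    rw [Finset.mul_sum]
    refine Finset.sum_congr rfl fun m _ => ?_
    ring
  · intro l hl hne
    have := sum_phase_mode (Finset.mem_range.1 hl) hj
    rw [if_neg hne] at this
    rw [← Finset.sum_smul]
    convert zero_smul ℂ _
    rw [← mul_zero (L : ℂ)⁻¹, ← this, Finset.mul_sum]
    refine Finset.sum_congr rfl fun m _ => ?_
    ring
  · intro h
    exact absurd (Finset.mem_range.2 hj) h

theorem creationField_card (hL : L ≠ 0) : creationField L L = -fermion 0 true := by
  rw [← creationField_of_lt (by omega : 0 < L), creationField, creationField,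
    ← Finset.sum_neg_distrib]
  refine Finset.sum_congr rfl fun m _ => ?_
  rw [inv_pow, phase_pow_card hL, pow_zero, one_smul, inv_neg, inv_one]
  module

theorem modeCreate_anticomm (m p : ℕ) :
    modeCreate L m * modeCreate L p = -(modeCreate L p * modeCreate L m) := by
  simp only [modeCreate, Finset.sum_mul_sum, smul_mul_smul_comm]
  rw [← Finset.sum_neg_distrib]
  rw [Finset.sum_comm]
  refine Finset.sum_congr rfl fun i hi => ?_
  rw [← Finset.sum_neg_distrib]
  refine Finset.sum_congr rfl fun j hj => ?_
  rw [fermion_same_anticomm true (Finset.mem_range.1 hj) (Finset.mem_range.1 hi),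
    smul_neg, mul_comm]

/-- The whole factor `1/L` sits in the annihilator; the canonical relations then hold without any
`√L`. -/
theorem modeAnnihilate_mul_modeCreate {m p : ℕ} (hm : m < L) (hp : p < L) :
    modeAnnihilate L m * modeCreate L p =
      (if m = p then 1 else 0) - modeCreate L p * modeAnnihilate L m := by
  have hL : (L : ℂ) ≠ 0 := Nat.cast_ne_zero.2 (by omega)
  have h1 : modeAnnihilate L m * modeCreate L p + modeCreate L p * modeAnnihilate L m =
      (L : ℂ)⁻¹ • ∑ i ∈ Finset.range L, ∑ j ∈ Finset.range L,
        ((phase L m)⁻¹ ^ i * phase L p ^ j) • (if i = j then 1 else 0) := by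
    simp only [modeAnnihilate, modeCreate, smul_mul_assoc, mul_smul_comm, Finset.sum_mul_sum]
    rw [← smul_add]
    congr 1
    conv_lhs =>
      enter [2]
      rw [Finset.sum_comm]
    rw [← Finset.sum_add_distrib]
    refine Finset.sum_congr rfl fun i hi => ?_
    rw [← Finset.sum_add_distrib]
    refine Finset.sum_congr rfl fun j hj => ?_
    rw [annihilate_mul_create (Finset.mem_range.1 hi) (Finset.mem_range.1 hj), smul_smul, smul_smul,
      mul_comm (phase L p ^ j), ← smul_add, sub_add_cancel]
  rw [eq_sub_iff_add_eq, h1]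
  simp only [smul_ite, smul_zero, Finset.sum_ite_eq]
  rw [Finset.sum_congr rfl (fun i hi => if_pos hi), ← Finset.sum_smul]
  have h2 := sum_phase_site hp hm
  simp_rw [mul_comm (_⁻¹ ^ _)]
  rw [h2, smul_smul]
  rcases eq_or_ne m p with rfl | h
  · simp [hL]
  · simp [h, h.symm]

end Fourier

/-! ### The tilted generator as a quadratic form in the modes. -/

section Hamiltonian

variable {L : ℕ}

/-- The generator tilted by the weight `x` per particle jump, on complex functions. -/
noncomputable def tiltedGeneratorC (w μ x : ℝ) (L : ℕ) (f : Config L → ℂ) (η : Config L) : ℂ :=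
  ∑ k ∈ Finset.range L,
    ((μ + w * x * (occ η (k : ZMod L) + occ η ((k : ZMod L) + 1))) * f (flip η (k : ZMod L))
      - (μ + w * (occ η (k : ZMod L) + occ η ((k : ZMod L) + 1))) * f η)

theorem sum_flip_eq_bondOperator (hL : 2 ≤ L) (w μ x : ℂ) {f : Config L → ℂ}
    (hf : EvenSupported f) (η : Config L) :
    ∑ k ∈ Finset.range L,
      (μ + w * x * (occ η (k : ZMod L) + occ η ((k : ZMod L) + 1))) * f (flip η (k : ZMod L)) =
    (∑ k ∈ Finset.range L, bondOperator (μ + 2 * w * x) (μ + w * x) μ (annihilationField L k)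
      (creationField L k) (annihilationField L (k + 1)) (creationField L (k + 1))) f η := by
  rw [LinearMap.sum_apply, Finset.sum_apply]
  refine Finset.sum_congr rfl fun k hk => ?_
  have hk := Finset.mem_range.1 hk
  rw [annihilationField_of_lt hk, creationField_of_lt hk]
  rcases Nat.lt_or_ge (k + 1) L with h | h
  · rw [annihilationField_of_lt h, creationField_of_lt h, bondOperator_apply_of_lt h]
  · have hkL : k + 1 = L := by omega
    rw [hkL, annihilationField_card (by omega), creationField_card (by omega),
      bondOperator_apply_last hkL.symm (by omega) w μ x hf]

theorem create_mul_annihilate_apply {k : ℕ} (hk : k < L) (f : Config L → ℂ) (η : Config L) :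
    (fermion k true * fermion k false : Module.End ℂ (Config L → ℂ)) f η =
      occ η (k : ZMod L) * f η := by
  have := stringSign_mul_self k η
  simp only [Module.End.mul_apply, fermion_apply, flipSite_self_apply,
    stringSign_flipSite_of_le hk le_rfl, flipSite_flipSite, occ]
  cases η (k : ZMod L) <;> simp [← mul_assoc, this]

theorem sum_occ_succ (η : Config L) :
    ∑ k ∈ Finset.range L, occ η ((k : ZMod L) + 1) = ∑ k ∈ Finset.range L, occ η (k : ZMod L) := by
  have h1 := Finset.sum_range_succ (fun k : ℕ => occ η (k : ZMod L)) L
  rw [Finset.sum_range_succ'] at h1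
  push_cast [ZMod.natCast_self] at h1
  exact add_right_cancel h1

theorem sum_create_mul_annihilate :
    ∑ k ∈ Finset.range L, (fermion k true : Module.End ℂ (Config L → ℂ)) * fermion k false =
      ∑ m ∈ Finset.range L, modeCreate L m * modeAnnihilate L m := by
  rcases Nat.eq_zero_or_pos L with rfl | h
  · simp
  have hL : (L : ℂ) ≠ 0 := Nat.cast_ne_zero.2 (by omega)
  have := sum_range_mul_of_orthogonal (fun m => (L : ℂ)⁻¹ • modeCreate L m) (modeAnnihilate L)
    (fun m => (phase L m)⁻¹) (phase L) id (fun m h => h)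
    (fun m hm p hp => by
      rw [id, ← sum_phase_site hp hm]
      exact Finset.sum_congr rfl fun k _ => mul_comm _ _) 0 0
  simp only [add_zero, pow_zero, mul_one, id, smul_mul_assoc, smul_smul, mul_inv_cancel₀ hL,
    one_smul] at this
  rw [← this]
  refine Finset.sum_congr rfl fun k hk => ?_
  rw [← annihilationField_of_lt (Finset.mem_range.1 hk), ← creationField_of_lt (Finset.mem_range.1 hk)]
  simp only [annihilationField, creationField, smul_smul]

/-- The contribution of a momentum mode to the tilted generator. -/
noncomputable def modeHamiltonian (w μ x : ℂ) (L m : ℕ) : Module.End ℂ (Config L → ℂ) :=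
  ((μ + w * x) * (phase L m + (phase L m)⁻¹) - 2 * w) • (modeCreate L m * modeAnnihilate L m) +
    ((μ + 2 * w * x) / L * phase L m) • (modeCreate L m * modeCreate L (L - 1 - m)) -
    (μ * L * (phase L m)⁻¹) • (modeAnnihilate L m * modeAnnihilate L (L - 1 - m))

theorem sum_bondOperator (hL : L ≠ 0) (α a μ : ℂ) :
    ∑ k ∈ Finset.range L, bondOperator α a μ (annihilationField L k)
      (creationField L k) (annihilationField L (k + 1)) (creationField L (k + 1)) =
    ∑ m ∈ Finset.range L,
      ((a * (phase L m + (phase L m)⁻¹)) • (modeCreate L m * modeAnnihilate L m) +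
      (α / L * phase L m) • (modeCreate L m * modeCreate L (L - 1 - m)) -
      (μ * L * (phase L m)⁻¹) • (modeAnnihilate L m * modeAnnihilate L (L - 1 - m))) := by
  have hL' : (L : ℂ) ≠ 0 := Nat.cast_ne_zero.2 hL
  have hrefl : ∀ m < L, L - 1 - m < L := fun m h => by omega
  have horth1 : ∀ m < L, ∀ p < L, ∑ k ∈ Finset.range L, (phase L m)⁻¹ ^ k * phase L p ^ k =
      if p = id m then (L : ℂ) else 0 := fun m hm p hp => by
    rw [id, ← sum_phase_site hp hm]
    exact Finset.sum_congr rfl fun k _ => mul_comm _ _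
  have horth2 : ∀ m < L, ∀ p < L, ∑ k ∈ Finset.range L, (phase L m)⁻¹ ^ k * (phase L p)⁻¹ ^ k =
      if p = L - 1 - m then (L : ℂ) else 0 := fun m hm p hp => by
    rw [← phase_reflect hm, sum_phase_site (hrefl m hm) hp]
    simp only [eq_comm]
  have horth3 : ∀ m < L, ∀ p < L, ∑ k ∈ Finset.range L, phase L m ^ k * phase L p ^ k =
      if p = L - 1 - m then (L : ℂ) else 0 := fun m hm p hp => by
    have := sum_phase_site hp (hrefl m hm)
    rw [phase_reflect hm, inv_inv] at this
    rw [← this]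
    exact Finset.sum_congr rfl fun k _ => mul_comm _ _
  have h1 := sum_range_mul_of_orthogonal (fun m => (L : ℂ)⁻¹ • modeCreate L m) (modeAnnihilate L)
    (fun m => (phase L m)⁻¹) (phase L) id (fun m h => h) horth1 0 1
  have h2 := sum_range_mul_of_orthogonal (fun m => (L : ℂ)⁻¹ • modeCreate L m) (modeAnnihilate L)
    (fun m => (phase L m)⁻¹) (phase L) id (fun m h => h) horth1 1 0
  have h3 := sum_range_mul_of_orthogonal (fun m => (L : ℂ)⁻¹ • modeCreate L m)
    (fun m => (L : ℂ)⁻¹ • modeCreate L m)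
    (fun m => (phase L m)⁻¹) (fun m => (phase L m)⁻¹) (fun m => L - 1 - m) hrefl horth2 0 1
  have h4 := sum_range_mul_of_orthogonal (modeAnnihilate L) (modeAnnihilate L)
    (phase L) (phase L) (fun m => L - 1 - m) hrefl horth3 0 1
  simp only [bondOperator]
  rw [Finset.sum_sub_distrib, Finset.sum_add_distrib, ← Finset.smul_sum, ← Finset.smul_sum,
    ← Finset.smul_sum, Finset.sum_add_distrib]
  simp only [annihilationField, creationField]
  simp only [add_zero] at h1 h2 h3 h4
  rw [h1, h2, h3, h4, ← Finset.sum_add_distrib, Finset.smul_sum, Finset.smul_sum, Finset.smul_sum,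
    ← Finset.sum_add_distrib, ← Finset.sum_sub_distrib]
  refine Finset.sum_congr rfl fun m hm => ?_
  have hm := Finset.mem_range.1 hm
  rw [phase_reflect hm, inv_inv]
  simp only [pow_zero, pow_one, mul_one, id, smul_mul_assoc, smul_smul,
    mul_smul_comm]
  have e1 : (L : ℂ) * phase L m * (L : ℂ)⁻¹ = phase L m := by field_simp
  have e2 : (L : ℂ) * (phase L m)⁻¹ * (L : ℂ)⁻¹ = (phase L m)⁻¹ := by field_simp
  have e3 : α * ((L : ℂ) * phase L m * ((L : ℂ)⁻¹ * (L : ℂ)⁻¹)) = α / L * phase L m := by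
    field_simp
  rw [e1, e2, e3, ← add_smul, smul_smul, mul_assoc μ]

theorem tiltedGeneratorC_eq (hL : 2 ≤ L) (w μ x : ℝ) {f : Config L → ℂ}
    (hf : EvenSupported f) (η : Config L) :
    tiltedGeneratorC w μ x L f η =
      (∑ m ∈ Finset.range L, modeHamiltonian w μ x L m) f η - μ * L * f η := by
  have hmode : ∑ m ∈ Finset.range L, modeHamiltonian w μ x L m =
      (∑ k ∈ Finset.range L, bondOperator ((μ : ℂ) + 2 * w * x) (μ + w * x) μ
        (annihilationField L k) (creationField L k) (annihilationField L (k + 1))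
        (creationField L (k + 1))) -
      (2 * w : ℂ) • ∑ k ∈ Finset.range L,
        (fermion k true : Module.End ℂ (Config L → ℂ)) * fermion k false := by
    rw [sum_bondOperator (by omega), sum_create_mul_annihilate, Finset.smul_sum,
      ← Finset.sum_sub_distrib]
    refine Finset.sum_congr rfl fun m _ => ?_
    rw [modeHamiltonian]
    module
  rw [hmode, LinearMap.sub_apply, Pi.sub_apply, ← sum_flip_eq_bondOperator hL _ _ _ hf,
    LinearMap.smul_apply, Pi.smul_apply, LinearMap.sum_apply, Finset.sum_apply,
    Finset.sum_congr rfl fun k hk => create_mul_annihilate_apply (Finset.mem_range.1 hk) f η,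
    tiltedGeneratorC, Finset.sum_sub_distrib, ← Finset.sum_mul, ← Finset.sum_mul,
    Finset.sum_add_distrib, ← Finset.mul_sum, Finset.sum_add_distrib]
  have h := congrArg (fun r : ℝ => (r : ℂ)) (sum_occ_succ η)
  push_cast at h
  rw [h]
  simp
  ring

/-- Trading annihilators for creators on `v`, mode `m` yields a scalar plus a residue times `D m (D
(L - 1 - m) v)`. This two-creator vector is odd under reflection, so the residue need not vanish: it
suffices that it be even (`hric`). -/
theorem mode_eigen {V : Type*} [AddCommGroup V] [Module ℂ V] (L : ℕ) (C D : ℕ → Module.End ℂ V)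
    (A β γ G : ℕ → ℂ) (v : V)
    (hDD : ∀ m p, D m * D p = -(D p * D m))
    (hCD : ∀ m < L, C m * D m = 1 - D m * C m)
    (hC : ∀ m < L, C m v = G m • D (L - 1 - m) v)
    (hG : ∀ m < L, G (L - 1 - m) = -G m)
    (hric : ∀ m < L, A m * G m + β m - γ m * G m ^ 2 =
      A (L - 1 - m) * G (L - 1 - m) + β (L - 1 - m) - γ (L - 1 - m) * G (L - 1 - m) ^ 2) :
    (∑ m ∈ Finset.range L, (A m • (D m * C m) + β m • (D m * D (L - 1 - m)) -
      γ m • (C m * C (L - 1 - m)))) v = (∑ m ∈ Finset.range L, γ m * G m) • v := by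
  have key : ∀ m < L, (A m • (D m * C m) + β m • (D m * D (L - 1 - m)) -
      γ m • (C m * C (L - 1 - m))) v = (γ m * G m) • v +
      (A m * G m + β m - γ m * G m ^ 2) • D m (D (L - 1 - m) v) := by
    intro m hm
    have h1 : C m (D m v) = v - G m • D m (D (L - 1 - m) v) := by
      have := LinearMap.congr_fun (hCD m hm) v
      simp only [Module.End.mul_apply, LinearMap.sub_apply, Module.End.one_apply, hC m hm,
        map_smul] at this
      exact this
    have h2 : C (L - 1 - m) v = -G m • D m v := by
      rw [hC _ (by omega), hG m hm, show L - 1 - (L - 1 - m) = m by omega]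
    simp only [LinearMap.sub_apply, LinearMap.add_apply, LinearMap.smul_apply,
      Module.End.mul_apply, h2, hC m hm, map_smul, h1]
    module
  rw [LinearMap.sum_apply, Finset.sum_congr rfl fun m hm => key m (Finset.mem_range.1 hm),
    Finset.sum_add_distrib, ← Finset.sum_smul, add_eq_left]
  set S := ∑ m ∈ Finset.range L,
    (A m * G m + β m - γ m * G m ^ 2) • D m (D (L - 1 - m) v) with hS
  have hneg : S = -S := by
    conv_lhs => rw [hS, ← Finset.sum_range_reflect]
    rw [hS, ← Finset.sum_neg_distrib]
    refine Finset.sum_congr rfl fun m hm => ?_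
    have hm := Finset.mem_range.1 hm
    have hd := LinearMap.congr_fun (hDD (L - 1 - m) m) v
    simp only [Module.End.mul_apply, LinearMap.neg_apply] at hd
    rw [← hric m hm, show L - 1 - (L - 1 - m) = m by omega, hd, smul_neg]
  have h2 : (2 : ℂ) • S = 0 := by
    rw [two_smul]
    exact eq_neg_iff_add_eq_zero.1 hneg
  exact (smul_eq_zero.1 h2).resolve_left two_ne_zero

end Hamiltonian

/-! ### The paired state. -/

section PairState

variable {L : ℕ}

theorem modeAnnihilate_pair {m p r : ℕ} (hm : m < L) (hp : p < L) (hr : r < L)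
    (f : Config L → ℂ) :
    modeAnnihilate L m (modeCreate L p (modeCreate L r f)) =
      (if m = p then (1 : ℂ) else 0) • modeCreate L r f -
      (if m = r then (1 : ℂ) else 0) • modeCreate L p f +
      modeCreate L p (modeCreate L r (modeAnnihilate L m f)) := by
  have h1 := LinearMap.congr_fun (modeAnnihilate_mul_modeCreate hm hp) (modeCreate L r f)
  have h2 := LinearMap.congr_fun (modeAnnihilate_mul_modeCreate hm hr) f
  simp only [Module.End.mul_apply, LinearMap.sub_apply] at h1 h2
  rw [h1, h2, map_sub]
  have e : ∀ (P : Prop) [Decidable P] (g : Config L → ℂ),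
      (if P then (1 : Module.End ℂ (Config L → ℂ)) else 0) g = (if P then (1 : ℂ) else 0) • g := by
    intro P _ g
    split_ifs <;> simp
  rw [e, e, map_smul]
  module

theorem modeCreate_modeCreate (m p : ℕ) (f : Config L → ℂ) :
    modeCreate L m (modeCreate L p f) = -modeCreate L p (modeCreate L m f) :=
  LinearMap.congr_fun (modeCreate_anticomm m p) f

theorem modeCreate_modeCreate_self (m : ℕ) (f : Config L → ℂ) :
    modeCreate L m (modeCreate L m f) = 0 :=
  self_eq_neg.1 (modeCreate_modeCreate m m f)

open Classical in
/-- The indicator function of the empty configuration. -/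
noncomputable def vacuum (L : ℕ) : Config L → ℂ := fun η => if η = fun _ => false then 1 else 0

/-- The paired state: the first `n` pairs of opposite modes are filled with amplitudes `G`. -/
noncomputable def pairState (L : ℕ) (G : ℕ → ℂ) : ℕ → Config L → ℂ
  | 0 => vacuum L
  | n + 1 => pairState L G n +
      G n • modeCreate L n (modeCreate L (L - 1 - n) (pairState L G n))

theorem modeAnnihilate_vacuum (m : ℕ) : modeAnnihilate L m (vacuum L) = 0 := by
  have : ∀ j : ℕ, fermion j false (vacuum L) = 0 := by
    intro j
    ext η
    rw [fermion_apply]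
    split_ifs with h
    · rw [vacuum, if_neg, mul_zero]
      · rfl
      · intro h'
        have := congrFun h' (j : ZMod L)
        rw [flipSite_self_apply, h] at this
        simp at this
    · rfl
  simp [modeAnnihilate, this]

/-- Annihilating one member of a filled pair leaves its partner, and the creator of the partner
kills the filled part. Hence the relation may be written with the full state on the right. Oddness
of `G` makes both members of a pair agree. -/
theorem modeAnnihilate_pairState {G : ℕ → ℂ} (hG : ∀ m < L, G (L - 1 - m) = -G m) {n : ℕ}
    (hn : 2 * n ≤ L) {m : ℕ} (hm : m < L) :
    modeAnnihilate L m (pairState L G n) =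
      (if m < n ∨ L - 1 - m < n then G m else 0) • modeCreate L (L - 1 - m) (pairState L G n) := by
  induction n generalizing m with
  | zero => simp [pairState, modeAnnihilate_vacuum]
  | succ n ih =>
    have ih := fun m (hm : m < L) => ih (by omega) hm
    set u := pairState L G n with hu
    have hv : pairState L G (n + 1) =
      u + G n • modeCreate L n (modeCreate L (L - 1 - n) u) := rfl
    rw [hv]
    simp only [map_add, map_smul]
    rw [modeAnnihilate_pair hm (by omega) (by omega)]
    have h1 := ih n (by omega)
    rw [if_neg (by omega), zero_smul] at h1
    have h2 := ih (L - 1 - n) (by omega)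
    rw [if_neg (by omega), zero_smul] at h2
    by_cases e1 : m = n
    · subst e1
      rw [h1, if_pos rfl, if_neg (by omega), if_pos (by omega),
        modeCreate_modeCreate (L - 1 - m) m, modeCreate_modeCreate_self]
      simp
    · by_cases e2 : m = L - 1 - n
      · subst e2
        rw [h2, if_pos rfl, if_neg (by omega), if_pos (by omega),
          show L - 1 - (L - 1 - n) = n by omega, modeCreate_modeCreate_self, hG n (by omega)]
        simp
      · rw [if_neg e1, if_neg e2, ih m hm]
        have : (m < n + 1 ∨ L - 1 - m < n + 1) ↔ (m < n ∨ L - 1 - m < n) := by omega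
        simp only [this, map_smul]
        rw [modeCreate_modeCreate (L - 1 - m) n, modeCreate_modeCreate (L - 1 - m) (L - 1 - n),
          map_neg]
        module

theorem modeCreate_apply_empty (m : ℕ) (f : Config L → ℂ) :
    modeCreate L m f (fun _ => false) = 0 := by
  simp [modeCreate, LinearMap.sum_apply, Finset.sum_apply, fermion_apply]

/-- This normalization, independent of the amplitudes, is what later prevents the eigenvector from
degenerating as `s` varies. -/
theorem pairState_apply_empty (G : ℕ → ℂ) (n : ℕ) : pairState L G n (fun _ => false) = 1 := by
  induction n with
  | zero => simp [pairState, vacuum]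
  | succ n ih => simp [pairState, ih, modeCreate_apply_empty]

theorem stringSign_mul_modeCreate (m : ℕ) (f : Config L → ℂ) (η : Config L) :
    stringSign L η * modeCreate L m f η = -modeCreate L m (fun ζ => stringSign L ζ * f ζ) η := by
  simp only [modeCreate, LinearMap.sum_apply, Finset.sum_apply, LinearMap.smul_apply,
    Pi.smul_apply, smul_eq_mul]
  rw [Finset.mul_sum, ← Finset.sum_neg_distrib]
  refine Finset.sum_congr rfl fun j hj => ?_
  rw [mul_left_comm, stringSign_mul_fermion (Finset.mem_range.1 hj)]
  ring

theorem EvenSupported.pair {f : Config L → ℂ} (hf : EvenSupported f) (m p : ℕ) :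
    EvenSupported (modeCreate L m (modeCreate L p f)) := fun η => by
  have h : (fun ζ => stringSign L ζ * modeCreate L p f ζ) = -modeCreate L p f := by
    ext ζ
    rw [stringSign_mul_modeCreate, (funext hf : (fun ζ => stringSign L ζ * f ζ) = f)]
    rfl
  rw [stringSign_mul_modeCreate, h, map_neg, Pi.neg_apply, neg_neg]

theorem evenSupported_pairState (G : ℕ → ℂ) (n : ℕ) : EvenSupported (pairState L G n) := by
  induction n with
  | zero =>
    intro η
    by_cases h : η = fun _ => false
    · subst h
      simp [stringSign, siteSign]
    · simp [pairState, vacuum, h]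
  | succ n ih => exact ih.add ((ih.pair _ _).smul _)

theorem continuous_pairState [NeZero L] {X : Type*} [TopologicalSpace X] {G : X → ℕ → ℂ}
    (hG : ∀ m, Continuous fun x => G x m) (n : ℕ) : Continuous fun x => pairState L (G x) n := by
  induction n with
  | zero => exact continuous_const
  | succ n ih =>
    refine ih.add ((hG n).smul ?_)
    exact (LinearMap.continuous_of_finiteDimensional (modeCreate L n)).comp
      ((LinearMap.continuous_of_finiteDimensional (modeCreate L (L - 1 - n))).comp ih)

end PairState

/-! ### The explicit eigenvector and eigenvalue. -/

section Spectrum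

/-- The diagonal coefficient of a pair of opposite modes. -/
noncomputable def modeDiagonal (w μ x : ℝ) (L m : ℕ) : ℝ :=
  2 * (μ + w * x) * Real.cos (momentum L m) - 2 * w

/-- The discriminant of a pair of opposite modes. -/
noncomputable def modeDiscriminant (w μ x : ℝ) (L m : ℕ) : ℝ :=
  modeDiagonal w μ x L m ^ 2 + 4 * (μ + 2 * w * x) * μ * Real.sin (momentum L m) ^ 2

/-- The rescaled amplitude of a pair of opposite modes in the dominant eigenvector. -/
noncomputable def pairRatio (w μ x : ℝ) (L m : ℕ) : ℝ :=
  -(modeDiagonal w μ x L m + √(modeDiscriminant w μ x L m)) / (2 * μ * Real.sin (momentum L m))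

/-- The dominant eigenvalue of the tilted generator in the even sector. -/
noncomputable def topEigenvalue (w μ x : ℝ) (L : ℕ) : ℝ :=
  -(μ + w) * L + (∑ m ∈ Finset.range L, √(modeDiscriminant w μ x L m)) / 2

/-- The amplitude of a pair of opposite modes in the dominant eigenvector. -/
noncomputable def pairAmplitude (w μ x : ℝ) (L m : ℕ) : ℂ :=
  -Complex.I * pairRatio w μ x L m / L

/-- The dominant eigenvector of the tilted generator in the even sector. -/
noncomputable def topVector (w μ x : ℝ) (L : ℕ) : Config L → ℂ :=
  pairState L (pairAmplitude w μ x L) (L / 2)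

variable {L : ℕ}

theorem phase_eq_cos_add_sin (L m : ℕ) :
    phase L m = Real.cos (momentum L m) + Real.sin (momentum L m) * Complex.I := by
  rw [phase, Complex.exp_mul_I, Complex.ofReal_cos, Complex.ofReal_sin]

theorem momentum_reflect {m : ℕ} (hm : m < L) :
    momentum L (L - 1 - m) = 2 * Real.pi - momentum L m := by
  have hL : (L : ℝ) ≠ 0 := Nat.cast_ne_zero.2 (by omega)
  obtain ⟨k, rfl⟩ : ∃ k, L = m + 1 + k := ⟨L - 1 - m, by omega⟩
  rw [show m + 1 + k - 1 - m = k by omega, momentum, momentum]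
  push_cast at hL ⊢
  field_simp
  ring

theorem cos_momentum_reflect {m : ℕ} (hm : m < L) :
    Real.cos (momentum L (L - 1 - m)) = Real.cos (momentum L m) := by
  rw [momentum_reflect hm, Real.cos_two_pi_sub]

theorem sin_momentum_reflect {m : ℕ} (hm : m < L) :
    Real.sin (momentum L (L - 1 - m)) = -Real.sin (momentum L m) := by
  rw [momentum_reflect hm, Real.sin_two_pi_sub]

theorem inv_phase (L m : ℕ) :
    (phase L m)⁻¹ = Real.cos (momentum L m) - Real.sin (momentum L m) * Complex.I := by
  refine inv_eq_of_mul_eq_one_right ?_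
  rw [phase_eq_cos_add_sin]
  have h := congrArg (fun r : ℝ => (r : ℂ)) (Real.sin_sq_add_cos_sq (momentum L m))
  push_cast at h ⊢
  linear_combination h - Complex.sin (momentum L m) ^ 2 * Complex.I_sq

theorem cos_momentum_ne_one (hL : L ≠ 0) (m : ℕ) : Real.cos (momentum L m) ≠ 1 := by
  intro h
  have hs : Real.sin (momentum L m) = 0 := by
    have := Real.sin_sq_add_cos_sq (momentum L m)
    rw [h] at this
    nlinarith
  have h1 := phase_pow_card hL m
  rw [phase_eq_cos_add_sin, h, hs] at h1
  norm_num at h1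

theorem sum_cos_momentum (hL : 2 ≤ L) : ∑ m ∈ Finset.range L, Real.cos (momentum L m) = 0 := by
  have h := sum_phase_mode (by omega : 1 < L) (by omega : 0 < L)
  simp only [pow_one, pow_zero, mul_one, one_ne_zero, if_false] at h
  have := congrArg Complex.re h
  simpa [phase_eq_cos_add_sin, Complex.cos_ofReal_re] using this

variable {w μ x : ℝ}

theorem modeDiagonal_reflect {m : ℕ} (hm : m < L) :
    modeDiagonal w μ x L (L - 1 - m) = modeDiagonal w μ x L m := by
  rw [modeDiagonal, modeDiagonal, cos_momentum_reflect hm]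

theorem modeDiscriminant_reflect {m : ℕ} (hm : m < L) :
    modeDiscriminant w μ x L (L - 1 - m) = modeDiscriminant w μ x L m := by
  rw [modeDiscriminant, modeDiscriminant, modeDiagonal_reflect hm, sin_momentum_reflect hm, neg_sq]

theorem pairRatio_reflect {m : ℕ} (hm : m < L) :
    pairRatio w μ x L (L - 1 - m) = -pairRatio w μ x L m := by
  rw [pairRatio, pairRatio, modeDiagonal_reflect hm, modeDiscriminant_reflect hm,
    sin_momentum_reflect hm, mul_neg, div_neg]

theorem modeDiscriminant_nonneg (hw : 0 ≤ w) (hμ : 0 ≤ μ) (hx : 0 ≤ x) (L m : ℕ) :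
    0 ≤ modeDiscriminant w μ x L m := by
  unfold modeDiscriminant; positivity

/-- When `sin q = 0`, the division in `pairRatio` returns `0`. The momentum is then `π`, the
diagonal coefficient is nonpositive, and the right side vanishes too. -/
theorem two_mul_sin_mul_pairRatio (hw : 0 ≤ w) (hμ : 0 < μ) (hx : 0 ≤ x) (hL : L ≠ 0) (m : ℕ) :
    2 * μ * Real.sin (momentum L m) * pairRatio w μ x L m =
      -(modeDiagonal w μ x L m + √(modeDiscriminant w μ x L m)) := by
  rcases eq_or_ne (Real.sin (momentum L m)) 0 with h | h
  · have hc : Real.cos (momentum L m) = -1 := by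
      have h1 := Real.sin_sq_add_cos_sq (momentum L m)
      rw [h, zero_pow two_ne_zero, zero_add] at h1
      exact (mul_self_eq_one_iff.1 ((sq _).symm.trans h1)).resolve_left (cos_momentum_ne_one hL m)
    have hA : modeDiagonal w μ x L m ≤ 0 := by
      rw [modeDiagonal, hc]
      have : 0 ≤ w * x := mul_nonneg hw hx
      linarith
    rw [modeDiscriminant, h, zero_pow two_ne_zero, mul_zero (4 * _ * μ), add_zero,
      Real.sqrt_sq_eq_abs, abs_of_nonpos hA]
    ring
  · rw [pairRatio]
    field_simp

theorem pairRatio_riccati (hw : 0 ≤ w) (hμ : 0 < μ) (hx : 0 ≤ x) (hL : L ≠ 0) (m : ℕ) :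
    μ * Real.sin (momentum L m) * pairRatio w μ x L m ^ 2 +
      modeDiagonal w μ x L m * pairRatio w μ x L m =
      (μ + 2 * w * x) * Real.sin (momentum L m) := by
  rcases eq_or_ne (Real.sin (momentum L m)) 0 with h | h
  · simp [pairRatio, h]
  · have h1 := two_mul_sin_mul_pairRatio hw hμ hx hL m
    have h2 := Real.sq_sqrt (modeDiscriminant_nonneg hw hμ.le hx L m)
    rw [show √(modeDiscriminant w μ x L m) = -(2 * μ * Real.sin (momentum L m) *
      pairRatio w μ x L m + modeDiagonal w μ x L m) by linarith] at h2
    conv_rhs at h2 => rw [modeDiscriminant]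
    have h3 : 4 * μ * Real.sin (momentum L m) ≠ 0 := by positivity
    refine mul_left_cancel₀ h3 ?_
    linear_combination h2

theorem pairAmplitude_reflect {m : ℕ} (hm : m < L) :
    pairAmplitude w μ x L (L - 1 - m) = -pairAmplitude w μ x L m := by
  rw [pairAmplitude, pairAmplitude, pairRatio_reflect hm]
  push_cast
  ring

theorem modeAnnihilate_topVector {m : ℕ} (hm : m < L) :
    modeAnnihilate L m (topVector w μ x L) =
      pairAmplitude w μ x L m • modeCreate L (L - 1 - m) (topVector w μ x L) := by
  rw [topVector, modeAnnihilate_pairState (fun m hm => pairAmplitude_reflect hm) (by omega) hm]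
  split_ifs with h
  · rfl
  -- The only mode left unpaired is `q = π` for odd `L`; it is its own reflection, so its odd
  -- amplitude is zero.
  · have h1 : L - 1 - m = m := by omega
    have h2 := pairAmplitude_reflect (w := w) (μ := μ) (x := x) hm
    rw [h1, self_eq_neg] at h2
    rw [h2]

/-- Adding the reflected sum removes the cosine part of the phase. The diagonal coefficients then
sum to `-2wL`, since the cosines cancel for `L ≥ 2`. -/
theorem sum_mode_energy (hw : 0 ≤ w) (hμ : 0 < μ) (hx : 0 ≤ x) (hL : 2 ≤ L) :
    ∑ m ∈ Finset.range L, μ * L * (phase L m)⁻¹ * pairAmplitude w μ x L m =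
      (topEigenvalue w μ x L + μ * L : ℝ) := by
  have hL0 : (L : ℂ) ≠ 0 := Nat.cast_ne_zero.2 (by omega)
  have hd : ∑ m ∈ Finset.range L, modeDiagonal w μ x L m = -2 * w * L := by
    simp only [modeDiagonal]
    rw [Finset.sum_sub_distrib, ← Finset.mul_sum, sum_cos_momentum hL]
    simp
    ring
  have h2 : (2 : ℂ) * ∑ m ∈ Finset.range L, μ * L * (phase L m)⁻¹ * pairAmplitude w μ x L m =
      ∑ m ∈ Finset.range L,
        ((modeDiagonal w μ x L m + √(modeDiscriminant w μ x L m) : ℝ) : ℂ) := by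
    rw [two_mul]
    nth_rw 2 [← Finset.sum_range_reflect]
    rw [← Finset.sum_add_distrib]
    refine Finset.sum_congr rfl fun m hm => ?_
    have hm := Finset.mem_range.1 hm
    rw [← neg_neg (modeDiagonal w μ x L m + √(modeDiscriminant w μ x L m)),
      ← two_mul_sin_mul_pairRatio hw hμ hx (by omega) m, inv_phase, inv_phase,
      cos_momentum_reflect hm, sin_momentum_reflect hm, pairAmplitude_reflect hm, pairAmplitude]
    push_cast
    field_simp
    linear_combination
      (2 * μ * pairRatio w μ x L m * Complex.sin (momentum L m)) * Complex.I_sq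
  refine mul_left_cancel₀ two_ne_zero (h2.trans ?_)
  rw [← Complex.ofReal_sum, Finset.sum_add_distrib, hd, topEigenvalue]
  push_cast
  ring

theorem tiltedGeneratorC_topVector (hw : 0 ≤ w) (hμ : 0 < μ) (hx : 0 ≤ x) (hL : 2 ≤ L)
    (η : Config L) :
    tiltedGeneratorC w μ x L (topVector w μ x L) η =
      topEigenvalue w μ x L * topVector w μ x L η := by
  have hL0 : (L : ℂ) ≠ 0 := Nat.cast_ne_zero.2 (by omega)
  have heven : EvenSupported (topVector w μ x L) := evenSupported_pairState _ _
  rw [tiltedGeneratorC_eq hL w μ x heven η]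
  simp only [modeHamiltonian]
  have := mode_eigen L (modeAnnihilate L) (modeCreate L)
    (fun m => (μ + w * x) * (phase L m + (phase L m)⁻¹) - 2 * w)
    (fun m => (μ + 2 * w * x) / L * phase L m) (fun m => μ * L * (phase L m)⁻¹)
    (pairAmplitude w μ x L) (topVector w μ x L) modeCreate_anticomm
    (fun m hm => by simpa using modeAnnihilate_mul_modeCreate hm hm)
    (fun m hm => modeAnnihilate_topVector hm) (fun m hm => pairAmplitude_reflect hm)
    -- By the quadratic equation for `pairRatio` the sine part of the residue vanishes; the
    -- remaining cosine part is even.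
    (fun m hm => by
      have hr := congrArg (fun r : ℝ => (r : ℂ))
        (pairRatio_riccati hw hμ hx (by omega : L ≠ 0) m)
      simp only [modeDiagonal] at hr
      push_cast at hr
      simp only [inv_phase]
      simp only [phase_eq_cos_add_sin, cos_momentum_reflect hm,
        sin_momentum_reflect hm, pairAmplitude_reflect hm]
      simp only [pairAmplitude]
      push_cast
      field_simp
      ring_nf
      simp only [Complex.I_sq, Complex.I_pow_three]
      ring_nf at hr ⊢
      linear_combination (-2 * Complex.I) * hr)
  rw [this, Pi.smul_apply, sum_mode_energy hw hμ hx hL]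
  push_cast
  simp only [smul_eq_mul]
  ring

end Spectrum

/-! ### Positivity of the eigenvector. -/

section Positivity

/-- The generator tilted by the weight `x` per particle jump. -/
noncomputable def tiltedGenerator (w μ x : ℝ) (L : ℕ) : Module.End ℝ (Config L → ℝ) where
  toFun f η := ∑ k ∈ Finset.range L,
    ((μ + w * x * (occ η (k : ZMod L) + occ η ((k : ZMod L) + 1))) * f (flip η (k : ZMod L))
      - (μ + w * (occ η (k : ZMod L) + occ η ((k : ZMod L) + 1))) * f η)
  map_add' f g := by
    ext η
    refine Eq.trans ?_ Finset.sum_add_distrib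
    refine Finset.sum_congr rfl fun k _ => ?_
    simp only [Pi.add_apply]
    ring
  map_smul' r f := by
    ext η
    refine Eq.trans ?_ (Finset.mul_sum _ _ _).symm
    refine Finset.sum_congr rfl fun k _ => ?_
    simp only [Pi.smul_apply, smul_eq_mul, RingHom.id_apply]
    ring

variable {L : ℕ} {w μ x : ℝ}

theorem tiltedGenerator_apply (f : Config L → ℝ) (η : Config L) :
    tiltedGenerator w μ x L f η = ∑ k ∈ Finset.range L,
    ((μ + w * x * (occ η (k : ZMod L) + occ η ((k : ZMod L) + 1))) * f (flip η (k : ZMod L))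
      - (μ + w * (occ η (k : ZMod L) + occ η ((k : ZMod L) + 1))) * f η) := rfl

theorem occ_nonneg (η : Config L) (k : ZMod L) : 0 ≤ occ η k := Nat.cast_nonneg _

theorem occ_le_one (η : Config L) (k : ZMod L) : occ η k ≤ 1 := by
  unfold occ; cases η k <;> simp

theorem re_tiltedGeneratorC (f : Config L → ℂ) (η : Config L) :
    (tiltedGeneratorC w μ x L f η).re = tiltedGenerator w μ x L (fun ζ => (f ζ).re) η := by
  rw [tiltedGeneratorC, tiltedGenerator_apply, Complex.re_sum]
  refine Finset.sum_congr rfl fun k _ => ?_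
  rw [Complex.sub_re, ← Complex.re_ofReal_mul, ← Complex.re_ofReal_mul]
  push_cast
  rfl

theorem tiltedGenerator_re_topVector (hw : 0 ≤ w) (hμ : 0 < μ) (hx : 0 ≤ x) (hL : 2 ≤ L) :
    tiltedGenerator w μ x L (fun ζ => (topVector w μ x L ζ).re) =
      topEigenvalue w μ x L • fun ζ => (topVector w μ x L ζ).re := by
  ext η
  rw [← re_tiltedGeneratorC, tiltedGeneratorC_topVector hw hμ hx hL, Complex.re_ofReal_mul]
  rfl

/-- Irreducibility of the even sector: sweeping from site `0`, each particle met is pushed onto the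
next site, and parity forces the last site to end up empty. -/
theorem eq_zero_of_flip {P : Config L → Prop} (hL : 2 ≤ L)
    (hflip : ∀ η, IsEven η → P η → ∀ k < L, P (flip η (k : ZMod L))) {η : Config L}
    (hη : IsEven η) (h : P η) : P fun _ => false := by
  have hz : NeZero L := ⟨by omega⟩
  have sweep : ∀ n < L, ∃ ζ : Config L, IsEven ζ ∧ P ζ ∧ ∀ i < n, ζ ((i : ℕ) : ZMod L) = false := by
    intro n
    induction n with
    | zero => exact fun _ => ⟨η, hη, h, fun i hi => absurd hi (Nat.not_lt_zero i)⟩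
    | succ n ih =>
      intro hn
      obtain ⟨ζ, h1, h2, h3⟩ := ih (by omega)
      rcases hζ : ζ (n : ZMod L) with _ | _
      · refine ⟨ζ, h1, h2, fun i hi => ?_⟩
        rcases Nat.lt_succ_iff_lt_or_eq.1 hi with hi | rfl
        · exact h3 i hi
        · exact hζ
      · refine ⟨flip ζ (n : ZMod L), isEven_flip hL (by omega) h1, hflip ζ h1 h2 n (by omega),
          fun i hi => ?_⟩
        rw [flip_eq_of_lt hn]
        rcases Nat.lt_succ_iff_lt_or_eq.1 hi with hi | rfl
        · rw [flipSite_apply_of_ne (by omega) (by omega) (by omega),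
            flipSite_apply_of_ne (by omega) (by omega) (by omega), h3 i hi]
        · rw [flipSite_self_apply, flipSite_apply_of_ne (by omega) (by omega) (by omega), hζ]
          rfl
  obtain ⟨n, rfl⟩ : ∃ n, L = n + 1 := ⟨L - 1, by omega⟩
  obtain ⟨ζ, h1, h2, h3⟩ := sweep n (by omega)
  have hlast : ζ (n : ZMod (n + 1)) = false := by
    rw [IsEven, Finset.sum_range_succ, Finset.sum_eq_zero, zero_add] at h1
    · rcases hb : ζ (n : ZMod (n + 1)) with _ | _
      · rfl
      · rw [hb] at h1
        exact absurd h1 (by decide)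
    · intro i hi
      rw [h3 i (Finset.mem_range.1 hi)]
      rfl
  suffices hζ : (fun _ => false : Config (n + 1)) = ζ by rwa [hζ]
  funext j
  rw [← ZMod.natCast_zmod_val j]
  rcases Nat.lt_succ_iff_lt_or_eq.1 (ZMod.val_lt j) with hj | hj
  · rw [h3 _ hj]
  · rw [hj, hlast]

/-- At a zero of `f` the eigenvalue equation is a vanishing sum of nonnegative terms with positive
weights, so the zero spreads to all flipped configurations. -/
theorem eq_zero_at_empty (hw : 0 ≤ w) (hμ : 0 < μ) (hx : 0 ≤ x) (hL : 2 ≤ L) {f : Config L → ℝ}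
    (hf : ∀ η, IsEven η → 0 ≤ f η) {r : ℝ} (hr : tiltedGenerator w μ x L f = r • f)
    {η : Config L} (hη : IsEven η) (h0 : f η = 0) : f (fun _ => false) = 0 := by
  refine eq_zero_of_flip (P := fun ζ => f ζ = 0) hL (fun ζ hζ h k hk => ?_) hη h0
  have h1 := congrFun hr ζ
  rw [tiltedGenerator_apply, Pi.smul_apply, h, smul_zero] at h1
  simp only [mul_zero, sub_zero] at h1
  have hrate : ∀ k : ZMod L, 0 < μ + w * x * (occ ζ k + occ ζ (k + 1)) := fun k => by
    have := occ_nonneg ζ k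
    have := occ_nonneg ζ (k + 1)
    positivity
  rw [Finset.sum_eq_zero_iff_of_nonneg fun k hk => mul_nonneg (hrate _).le
    (hf _ (isEven_flip hL (Finset.mem_range.1 hk) hζ))] at h1
  exact (mul_eq_zero.1 (h1 k (Finset.mem_range.2 hk))).resolve_left (hrate _).ne'

theorem pos_of_eigen (hw : 0 ≤ w) (hμ : 0 < μ) (hx : 0 ≤ x) (hL : 2 ≤ L) {f : Config L → ℝ}
    (hf : ∀ η, IsEven η → 0 ≤ f η) (he : f (fun _ => false) ≠ 0) {r : ℝ}
    (hr : tiltedGenerator w μ x L f = r • f) {η : Config L} (hη : IsEven η) : 0 < f η :=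
  (hf η hη).lt_of_ne fun h => he (eq_zero_at_empty hw hμ hx hL hf hr hη h.symm)

theorem isEven_empty (L : ℕ) : IsEven (fun _ => false : Config L) := by
  simp [IsEven]

/-- Minimum principle: constants are harmonic for `x = 1`, so subtracting the minimum over the even
sector and spreading its zero to the empty configuration shows that the minimum is `1`. -/
theorem pos_of_harmonic [NeZero L] (hw : 0 ≤ w) (hμ : 0 < μ) (hL : 2 ≤ L) {f : Config L → ℝ}
    (he : f (fun _ => false) = 1) (hf : tiltedGenerator w μ 1 L f = 0) {η : Config L}
    (hη : IsEven η) : 0 < f η := by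
  obtain ⟨ζ, hζ, hmin⟩ := Set.exists_min_image {η : Config L | IsEven η} f (Set.toFinite _)
    ⟨fun _ => false, isEven_empty L⟩
  have hconst : tiltedGenerator w μ 1 L (f - fun _ => f ζ) = (0 : ℝ) • (f - fun _ => f ζ) := by
    rw [map_sub, hf, zero_smul, zero_sub, neg_eq_zero]
    ext θ
    simp [tiltedGenerator_apply]
  have := eq_zero_at_empty hw hμ zero_le_one hL (f := f - fun _ => f ζ)
    (fun θ hθ => sub_nonneg.2 (hmin θ hθ)) hconst hζ (sub_self _)
  rw [Pi.sub_apply, he] at this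
  have := hmin η hη
  linarith

/-- Without tilting, each discriminant is a perfect square. -/
theorem topEigenvalue_one (hw : 0 ≤ w) (hμ : 0 ≤ μ) (hL : 2 ≤ L) : topEigenvalue w μ 1 L = 0 := by
  have h : ∀ m, √(modeDiscriminant w μ 1 L m) =
      2 * (μ + w) - 2 * w * Real.cos (momentum L m) := by
    intro m
    have h1 := Real.cos_le_one (momentum L m)
    have h2 := Real.sin_sq_add_cos_sq (momentum L m)
    rw [← Real.sqrt_sq (by nlinarith :
      0 ≤ 2 * (μ + w) - 2 * w * Real.cos (momentum L m)), modeDiscriminant, modeDiagonal]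
    congr 1
    linear_combination (4 * (μ + 2 * w) * μ) * h2
  rw [topEigenvalue, Finset.sum_congr rfl fun m _ => h m, Finset.sum_sub_distrib,
    ← Finset.mul_sum _ _ (2 * w), sum_cos_momentum hL]
  simp
  ring

theorem continuous_topVector [NeZero L] (w μ : ℝ) :
    Continuous fun s : ℝ => topVector w μ (Real.exp s) L := by
  refine continuous_pairState (fun m => ?_) _
  unfold pairAmplitude pairRatio modeDiscriminant modeDiagonal
  fun_prop

theorem topVector_apply_empty (w μ x : ℝ) (L : ℕ) : topVector w μ x L (fun _ => false) = 1 :=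
  pairState_apply_empty _ _

theorem re_topVector_pos (hw : 0 ≤ w) (hμ : 0 < μ) (hL : 2 ≤ L) (s : ℝ) {η : Config L}
    (hη : IsEven η) : 0 < (topVector w μ (Real.exp s) L η).re := by
  have hz : NeZero L := ⟨by omega⟩
  set S : Set ℝ := {s | ∀ η : Config L, IsEven η → 0 < (topVector w μ (Real.exp s) L η).re} with hS
  have hcont : ∀ η : Config L, Continuous fun s : ℝ => (topVector w μ (Real.exp s) L η).re :=
    fun η => Complex.continuous_re.comp ((continuous_apply η).comp (continuous_topVector w μ))
  -- The strict and the weak inequalities define the same set, which is therefore both open and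
  -- closed in `ℝ`.
  have hS' : S = {s | ∀ η : Config L, IsEven η → 0 ≤ (topVector w μ (Real.exp s) L η).re} := by
    ext s
    refine ⟨fun h η hη => (h η hη).le, fun h η hη => ?_⟩
    refine pos_of_eigen hw hμ (Real.exp_pos s).le hL h ?_
      (tiltedGenerator_re_topVector hw hμ (Real.exp_pos s).le hL) hη
    rw [topVector_apply_empty]
    simp
  have hopen : IsOpen S := by
    simp only [hS, Set.ofPred_forall]
    exact isOpen_iInter_of_finite fun η => isOpen_iInter_of_finite fun _ =>
      isOpen_lt continuous_const (hcont η)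
  have hclosed : IsClosed S := by
    simp only [hS', Set.ofPred_forall]
    exact isClosed_iInter fun η => isClosed_iInter fun _ =>
      isClosed_le continuous_const (hcont η)
  have h0 : (0 : ℝ) ∈ S := by
    intro η hη
    rw [Real.exp_zero]
    refine pos_of_harmonic (f := fun η => (topVector w μ 1 L η).re) hw hμ hL ?_ ?_ hη
    · rw [topVector_apply_empty]
      simp
    · rw [tiltedGenerator_re_topVector hw hμ zero_le_one hL, topEigenvalue_one hw hμ.le hL,
        zero_smul]
  have huniv := IsClopen.eq_univ ⟨hclosed, hopen⟩ ⟨0, h0⟩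
  have hs : s ∈ S := huniv ▸ Set.mem_univ s
  exact hs η hη

end Positivity

/-! ### Growth rate of a semigroup with a positive eigenvector. -/

section Exponential

variable {ι : Type*} [Fintype ι]

/-- The exponential of an endomorphism of a finite-dimensional space of functions. -/
noncomputable def expEnd (T : Module.End ℝ (ι → ℝ)) : (ι → ℝ) →L[ℝ] (ι → ℝ) :=
  NormedSpace.exp (Module.End.toContinuousLinearMap (ι → ℝ) T)

theorem hasSum_expEnd (T : Module.End ℝ (ι → ℝ)) (f : ι → ℝ) (i : ι) :
    HasSum (fun m : ℕ => ((m.factorial : ℝ))⁻¹ * (T ^ m) f i) (expEnd T f i) := by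
  have h := NormedSpace.exp_series_hasSum_exp' (𝕂 := ℝ)
    (Module.End.toContinuousLinearMap (ι → ℝ) T)
  have h2 := (h.mapL (ContinuousLinearMap.apply ℝ (ι → ℝ) f)).mapL
    (ContinuousLinearMap.proj (R := ℝ) (φ := fun _ : ι => ℝ) i)
  convert h2 using 2 with m
  · rw [← map_pow]
    rfl
  · rfl

theorem expEnd_of_eigen {T : Module.End ℝ (ι → ℝ)} {f : ι → ℝ} {r : ℝ} (h : T f = r • f) (i : ι) :
    expEnd T f i = Real.exp r * f i := by
  have hpow : ∀ m : ℕ, (T ^ m) f = r ^ m • f := by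
    intro m
    induction m with
    | zero => simp
    | succ m ih => rw [pow_succ, Module.End.mul_apply, h, map_smul, ih, smul_smul, pow_succ']
  refine (hasSum_expEnd T f i).unique ?_
  have h1 := (NormedSpace.exp_series_hasSum_exp' (𝕂 := ℝ) r).mul_right (f i)
  rw [← Real.exp_eq_exp_ℝ] at h1
  have h2 : (fun m : ℕ => ((m.factorial : ℝ))⁻¹ * (T ^ m) f i) =
      fun m : ℕ => ((m.factorial : ℝ))⁻¹ • r ^ m * f i := by
    ext m
    rw [hpow, Pi.smul_apply, smul_eq_mul, smul_eq_mul, mul_assoc]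
  rw [h2]
  exact h1

theorem expEnd_nonneg_of_preserves {T : Module.End ℝ (ι → ℝ)} {s : Set ι}
    (hT : ∀ f : ι → ℝ, (∀ i ∈ s, 0 ≤ f i) → ∀ i ∈ s, 0 ≤ T f i) {f : ι → ℝ}
    (hf : ∀ i ∈ s, 0 ≤ f i) : ∀ i ∈ s, 0 ≤ expEnd T f i := by
  have hpow : ∀ m : ℕ, ∀ i ∈ s, 0 ≤ (T ^ m) f i := by
    intro m
    induction m with
    | zero => simpa using hf
    | succ m ih =>
      rw [pow_succ']
      exact hT _ ih
  intro i hi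
  exact (hasSum_expEnd T f i).nonneg fun m => mul_nonneg (by positivity) (hpow m i hi)

theorem expEnd_add_smul_one (T : Module.End ℝ (ι → ℝ)) (c : ℝ) :
    expEnd (T + c • 1) = Real.exp c • expEnd T := by
  let _ : NormedAlgebra ℚ ((ι → ℝ) →L[ℝ] (ι → ℝ)) := NormedAlgebra.restrictScalars ℚ ℝ _
  rw [expEnd, map_add, map_smul, map_one, NormedSpace.exp_add_of_commute, ← Algebra.algebraMap_eq_smul_one,
    ← NormedSpace.algebraMap_exp_comm, Algebra.algebraMap_eq_smul_one, mul_smul_comm, mul_one,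
    ← Real.exp_eq_exp_ℝ]
  · rfl
  · exact (Commute.one_right _).smul_right c

/-- Shifting `T` by `c` makes it positivity preserving and multiplies the exponential only by `exp
c`. -/
theorem expEnd_mono {T : Module.End ℝ (ι → ℝ)} {s : Set ι} {c : ℝ}
    (hT : ∀ f : ι → ℝ, (∀ i ∈ s, 0 ≤ f i) → ∀ i ∈ s, 0 ≤ T f i + c * f i) {f g : ι → ℝ}
    (hfg : ∀ i ∈ s, f i ≤ g i) {i : ι} (hi : i ∈ s) : expEnd T f i ≤ expEnd T g i := by
  have h := expEnd_nonneg_of_preserves (T := T + c • 1) (s := s) (f := g - f)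
    (fun f hf i hi => by simpa using hT f hf i hi) (fun i hi => sub_nonneg.2 (hfg i hi)) i hi
  rw [expEnd_add_smul_one, smul_apply, Pi.smul_apply, map_sub, smul_eq_mul,
    mul_nonneg_iff_of_pos_left (Real.exp_pos c)] at h
  exact sub_nonneg.1 h

/-- On `s`, the function `1` lies between `v / max v` and `v / min v`, on which the semigroup acts
by `exp (t r)`; the constants disappear after dividing the logarithm by `t`. -/
theorem tendsto_log_expEnd {T : Module.End ℝ (ι → ℝ)} {s : Set ι} {c : ℝ}
    (hT : ∀ f : ι → ℝ, (∀ i ∈ s, 0 ≤ f i) → ∀ i ∈ s, 0 ≤ T f i + c * f i) {v : ι → ℝ} {r : ℝ}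
    (hv : T v = r • v) (hpos : ∀ i ∈ s, 0 < v i) {i : ι} (hi : i ∈ s) :
    Tendsto (fun t : ℝ => Real.log (expEnd (t • T) 1 i) / t) atTop (𝓝 r) := by
  obtain ⟨a, ha, hmax⟩ := Set.exists_max_image s v (Set.toFinite _) ⟨i, hi⟩
  obtain ⟨b, hb, hmin⟩ := Set.exists_min_image s v (Set.toFinite _) ⟨i, hi⟩
  have hva := hpos a ha
  have hvb := hpos b hb
  have hvi := hpos i hi
  have hT' : ∀ t : ℝ, 0 ≤ t → ∀ f : ι → ℝ, (∀ i ∈ s, 0 ≤ f i) → ∀ i ∈ s,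
      0 ≤ (t • T) f i + (t * c) * f i := fun t ht f hf i hi => by
    have := mul_nonneg ht (hT f hf i hi)
    rw [LinearMap.smul_apply, Pi.smul_apply, smul_eq_mul]
    linarith
  have hev : ∀ t : ℝ, (t • T) v = (t * r) • v := fun t => by
    rw [LinearMap.smul_apply, hv, smul_smul]
  have hlow : ∀ t : ℝ, 0 ≤ t → (v a)⁻¹ * v i * Real.exp (t * r) ≤ expEnd (t • T) 1 i := by
    intro t ht
    have := expEnd_mono (hT' t ht) (f := (v a)⁻¹ • v) (g := 1) (fun j hj => by
      rw [Pi.smul_apply, smul_eq_mul, Pi.one_apply, inv_mul_le_one₀ hva]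
      exact hmax j hj) hi
    rw [map_smul, Pi.smul_apply, expEnd_of_eigen (hev t), smul_eq_mul] at this
    linarith
  have hupp : ∀ t : ℝ, 0 ≤ t → expEnd (t • T) 1 i ≤ (v b)⁻¹ * v i * Real.exp (t * r) := by
    intro t ht
    have := expEnd_mono (hT' t ht) (f := 1) (g := (v b)⁻¹ • v) (fun j hj => by
      rw [Pi.smul_apply, smul_eq_mul, Pi.one_apply, ← div_eq_inv_mul, one_le_div hvb]
      exact hmin j hj) hi
    rw [map_smul, Pi.smul_apply, expEnd_of_eigen (hev t), smul_eq_mul] at this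
    linarith
  have hlim : ∀ C : ℝ, Tendsto (fun t : ℝ => C / t + r) atTop (𝓝 r) := fun C => by
    simpa using (tendsto_const_nhds (x := C)).div_atTop tendsto_id |>.add_const r
  have hlog : ∀ C : ℝ, 0 < C → ∀ t : ℝ, 0 < t →
      Real.log (C * Real.exp (t * r)) / t = Real.log C / t + r := fun C hC t ht => by
    rw [Real.log_mul hC.ne' (Real.exp_ne_zero _), Real.log_exp]
    field_simp
  refine tendsto_of_tendsto_of_tendsto_of_le_of_le' (hlim (Real.log ((v a)⁻¹ * v i)))
    (hlim (Real.log ((v b)⁻¹ * v i))) ?_ ?_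
  · filter_upwards [eventually_gt_atTop 0] with t ht
    rw [← hlog _ (by positivity) t ht]
    gcongr
    exact hlow t ht.le
  · filter_upwards [eventually_gt_atTop 0] with t ht
    rw [← hlog _ (by positivity) t ht]
    have : 0 < expEnd (t • T) 1 i := lt_of_lt_of_le (by positivity) (hlow t ht.le)
    gcongr
    exact hupp t ht.le

end Exponential

/-! ### From the joint process to the tilted generator. -/

section JointProcess

variable {L : ℕ} {w μ : ℝ}

/-- The joint generator as an endomorphism. -/
noncomputable def jointGeneratorEnd (w μ : ℝ) (L : ℕ) : Module.End ℝ (Config L × ℕ → ℝ) where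
  toFun := jointGenerator w μ L
  map_add' f g := by
    ext y
    refine Eq.trans ?_ Finset.sum_add_distrib
    refine Finset.sum_congr rfl fun k _ => ?_
    simp only [Pi.add_apply]
    ring
  map_smul' r f := by
    ext y
    refine Eq.trans ?_ (Finset.mul_sum _ _ _).symm
    refine Finset.sum_congr rfl fun k _ => ?_
    simp only [Pi.smul_apply, smul_eq_mul, RingHom.id_apply]
    ring

theorem iterate_jointGenerator (m : ℕ) (f : Config L × ℕ → ℝ) :
    (jointGenerator w μ L)^[m] f = (jointGeneratorEnd w μ L ^ m) f :=
  (Module.End.pow_apply (jointGeneratorEnd w μ L) m f).symm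

/-- Each application raises the activity by at most one. So the `m`-th term of the semigroup series
involves only activities up to `m`, which makes the double series triangular. -/
theorem iterate_jointGenerator_congr (m : ℕ) {f g : Config L × ℕ → ℝ} {a : ℕ}
    (h : ∀ ζ, ∀ b, a ≤ b → b ≤ a + m → f (ζ, b) = g (ζ, b)) (η : Config L) :
    (jointGenerator w μ L)^[m] f (η, a) = (jointGenerator w μ L)^[m] g (η, a) := by
  induction m generalizing a η with
  | zero => exact h η a le_rfl le_rfl
  | succ m ih =>
    rw [Function.iterate_succ_apply', Function.iterate_succ_apply', jointGenerator, jointGenerator]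
    have h1 : ∀ ζ, _ = _ := ih (a := a) fun ζ b hb hb' => h ζ b hb (by omega)
    have h2 : ∀ ζ, _ = _ := ih (a := a + 1) fun ζ b hb hb' => h ζ b (by omega) (by omega)
    simp only [h1, h2]

theorem iterate_jointGenerator_exp (s : ℝ) (m : ℕ) :
    (jointGenerator w μ L)^[m] (fun y => Real.exp (s * y.2)) =
      fun y => Real.exp (s * y.2) * (tiltedGenerator w μ (Real.exp s) L ^ m) 1 y.1 := by
  induction m with
  | zero => ext; simp
  | succ m ih =>
    rw [Function.iterate_succ_apply', ih, pow_succ']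
    ext y
    rw [Module.End.mul_apply, tiltedGenerator_apply, Finset.mul_sum, jointGenerator]
    refine Finset.sum_congr rfl fun k _ => ?_
    have hs : Real.exp (s * (y.2 + 1 : ℕ)) = Real.exp (s * y.2) * Real.exp s := by
      rw [← Real.exp_add]
      push_cast
      ring_nf
    rw [hs]
    ring

theorem abs_jointGenerator_le (hw : 0 ≤ w) (hμ : 0 ≤ μ) {f : Config L × ℕ → ℝ} {B : ℝ}
    (hf : ∀ y, |f y| ≤ B) (y : Config L × ℕ) :
    |jointGenerator w μ L f y| ≤ L * (2 * μ + 4 * w) * B := by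
  have hB : 0 ≤ B := (abs_nonneg _).trans (hf y)
  rw [jointGenerator]
  refine (Finset.abs_sum_le_sum_abs _ _).trans ?_
  have : ∀ k ∈ Finset.range L, |μ * f (flip y.1 (k : ZMod L), y.2)
      + w * (occ y.1 (k : ZMod L) + occ y.1 ((k : ZMod L) + 1))
          * f (flip y.1 (k : ZMod L), y.2 + 1)
      - (μ + w * (occ y.1 (k : ZMod L) + occ y.1 ((k : ZMod L) + 1))) * f y| ≤
      (2 * μ + 4 * w) * B := by
    intro k _
    have h0 := occ_nonneg y.1 (k : ZMod L)
    have h1 := occ_nonneg y.1 ((k : ZMod L) + 1)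
    have h2 := occ_le_one y.1 (k : ZMod L)
    have h3 := occ_le_one y.1 ((k : ZMod L) + 1)
    have ho : 0 ≤ w * (occ y.1 (k : ZMod L) + occ y.1 ((k : ZMod L) + 1)) := by positivity
    have ho2 : w * (occ y.1 (k : ZMod L) + occ y.1 ((k : ZMod L) + 1)) ≤ 2 * w := by nlinarith
    set o := w * (occ y.1 (k : ZMod L) + occ y.1 ((k : ZMod L) + 1))
    clear_value o
    refine (abs_sub _ _).trans ((add_le_add (abs_add_le _ _) le_rfl).trans ?_)
    rw [abs_mul, abs_mul, abs_mul, abs_of_nonneg hμ, abs_of_nonneg ho,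
      abs_of_nonneg (add_nonneg hμ ho)]
    calc μ * |f (flip y.1 (k : ZMod L), y.2)| + o * |f (flip y.1 (k : ZMod L), y.2 + 1)|
          + (μ + o) * |f y| ≤ μ * B + (2 * w) * B + (μ + 2 * w) * B := by
          gcongr <;> apply hf
      _ = (2 * μ + 4 * w) * B := by ring
  refine (Finset.sum_le_sum this).trans_eq ?_
  rw [Finset.sum_const, Finset.card_range, nsmul_eq_mul, mul_assoc]

theorem abs_iterate_jointGenerator_le (hw : 0 ≤ w) (hμ : 0 ≤ μ) {f : Config L × ℕ → ℝ}
    (hf : ∀ y, |f y| ≤ 1) (m : ℕ) (y : Config L × ℕ) :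
    |(jointGenerator w μ L)^[m] f y| ≤ (L * (2 * μ + 4 * w)) ^ m := by
  induction m generalizing y with
  | zero => simpa using hf y
  | succ m ih =>
    rw [Function.iterate_succ_apply', pow_succ']
    exact abs_jointGenerator_le hw hμ ih y

theorem sum_iterate_jointGenerator (s : ℝ) (m : ℕ) (η : Config L) :
    ∑ n ∈ Finset.range (m + 1), (jointGenerator w μ L)^[m] (fun y => if y.2 = n then 1 else 0) (η, 0)
      * Real.exp (s * n) = (tiltedGenerator w μ (Real.exp s) L ^ m) 1 η := by
  have h := congrFun (iterate_jointGenerator_exp (L := L) (w := w) (μ := μ) s m) (η, 0)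
  simp only [Nat.cast_zero, mul_zero, Real.exp_zero, one_mul] at h
  rw [← h]
  have h2 := iterate_jointGenerator_congr (w := w) (μ := μ) m
    (f := fun y : Config L × ℕ => Real.exp (s * y.2))
    (g := ∑ n ∈ Finset.range (m + 1), Real.exp (s * n) • fun y => if y.2 = n then 1 else 0)
    (a := 0) (fun ζ b _ hb => by
      simp only [Finset.sum_apply, Pi.smul_apply, smul_eq_mul, mul_ite, mul_one, mul_zero]
      rw [Finset.sum_ite_eq, if_pos (Finset.mem_range.2 (by omega))]) η
  rw [h2, iterate_jointGenerator, map_sum, Finset.sum_apply]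
  refine Finset.sum_congr rfl fun n _ => ?_
  rw [map_smul, Pi.smul_apply, smul_eq_mul, iterate_jointGenerator, mul_comm]

theorem iterate_jointGenerator_of_lt {m n : ℕ} (h : m < n) (η : Config L) :
    (jointGenerator w μ L)^[m] (fun y => if y.2 = n then 1 else 0) (η, 0) = 0 := by
  rw [iterate_jointGenerator_congr m (g := 0) (fun ζ b _ hb => if_neg (by
    change b ≠ n
    omega)), iterate_jointGenerator, map_zero]
  rfl

theorem summable_triangle (y : ℝ) (hy : 0 ≤ y) :
    Summable fun p : ℕ × ℕ => if p.2 ≤ p.1 then y ^ p.1 / (p.1.factorial : ℝ) else 0 := by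
  have htsum : ∀ m : ℕ, HasSum (fun n => if n ≤ m then y ^ m / (m.factorial : ℝ) else 0)
      ((m + 1) * (y ^ m / (m.factorial : ℝ))) := by
    intro m
    have : HasSum (fun n => if n ≤ m then y ^ m / (m.factorial : ℝ) else 0)
        (∑ n ∈ Finset.range (m + 1), if n ≤ m then y ^ m / (m.factorial : ℝ) else 0) :=
      hasSum_sum_of_ne_finset_zero fun n hn => if_neg (by simpa using hn)
    rw [Finset.sum_congr rfl fun n hn => if_pos (by simpa [Nat.lt_succ_iff] using hn)] at this
    simpa using this
  rw [summable_prod_of_nonneg (fun p => by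
    change (0 : ℝ) ≤ if p.2 ≤ p.1 then _ else _
    split_ifs <;> positivity)]
  refine ⟨fun m => (htsum m).summable, ?_⟩
  simp only [fun m => (htsum m).tsum_eq]
  refine Summable.of_nonneg_of_le (fun m => by positivity) (fun m => ?_)
    (Real.summable_pow_div_factorial (2 * y))
  rw [mul_pow, mul_div_assoc]
  gcongr
  exact_mod_cast Nat.lt_two_pow_self (n := m)

theorem activityMGF_eq [NeZero L] (hw : 0 ≤ w) (hμ : 0 ≤ μ) (η : Config L) (s t : ℝ) :
    activityMGF w μ L η s t = expEnd (t • tiltedGenerator w μ (Real.exp s) L) 1 η := by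
  set a : ℕ → ℕ → ℝ := fun m n => t ^ m / (m.factorial : ℝ) *
    (jointGenerator w μ L)^[m] (fun y => if y.2 = n then 1 else 0) (η, 0) * Real.exp (s * n) with ha
  -- Absolute convergence on the triangle `n ≤ m`, with the weight `exp (s n)` absorbed into `exp
  -- |s| ^ m`, justifies exchanging the two sums.
  have hsum : Summable (Function.uncurry a) := by
    refine Summable.of_norm_bounded
      (summable_triangle (|t| * (L * (2 * μ + 4 * w)) * Real.exp |s|) (by positivity)) ?_
    rintro ⟨m, n⟩
    simp only [Function.uncurry_apply_pair, ha]
    rcases Nat.lt_or_ge m n with h | h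
    · rw [iterate_jointGenerator_of_lt h, if_neg (by omega)]
      simp
    · rw [if_pos h, Real.norm_eq_abs, abs_mul, abs_mul, Real.abs_exp, abs_div, abs_pow, Nat.abs_cast,
        mul_pow, mul_pow]
      have h1 := abs_iterate_jointGenerator_le (L := L) hw hμ
        (f := fun y => if y.2 = n then 1 else 0) (fun y => by split_ifs <;> simp) m (η, 0)
      have h2 : Real.exp (s * n) ≤ Real.exp |s| ^ m := by
        rw [← Real.exp_nat_mul, Real.exp_le_exp]
        have h3 : s * n ≤ |s| * n := mul_le_mul_of_nonneg_right (le_abs_self s) (Nat.cast_nonneg n)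
        have h4 : |s| * n ≤ |s| * m :=
          mul_le_mul_of_nonneg_left (Nat.cast_le.2 h) (abs_nonneg s)
        linarith
      calc _ ≤ |t| ^ m / (m.factorial : ℝ) * (L * (2 * μ + 4 * w)) ^ m * Real.exp |s| ^ m := by
            gcongr
        _ = _ := by ring
  have h1 : activityMGF w μ L η s t = ∑' n, ∑' m, a m n := by
    simp only [activityMGF, activityProb, semigroup, ha, tsum_mul_right]
  rw [h1, Summable.tsum_comm hsum, ← (hasSum_expEnd _ _ _).tsum_eq]
  refine tsum_congr fun m => ?_
  rw [tsum_eq_sum (s := Finset.range (m + 1))]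
  · simp only [ha]
    rw [smul_pow, LinearMap.smul_apply, Pi.smul_apply, ← sum_iterate_jointGenerator s m η,
      Finset.smul_sum, Finset.mul_sum]
    refine Finset.sum_congr rfl fun n _ => ?_
    rw [smul_eq_mul]
    ring
  · intro n hn
    simp only [ha]
    rw [iterate_jointGenerator_of_lt (by simpa using hn)]
    simp

theorem tendsto_scaledCGF (hw : 0 ≤ w) (hμ : 0 < μ) (hL : 2 ≤ L) {η : Config L}
    (hη : IsEven η) (s : ℝ) :
    Tendsto (fun t : ℝ => scaledCGF w μ L η s t) atTop
      (𝓝 (topEigenvalue w μ (Real.exp s) L / L)) := by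
  have hz : NeZero L := ⟨by omega⟩
  -- The shift `L (μ + 2w)` bounds the total exit rate of every configuration.
  have h := tendsto_log_expEnd (T := tiltedGenerator w μ (Real.exp s) L)
    (s := {η : Config L | IsEven η}) (c := L * (μ + 2 * w)) (fun f hf ζ hζ => ?_)
    (tiltedGenerator_re_topVector hw hμ (Real.exp_pos s).le hL)
    (fun ζ hζ => re_topVector_pos hw hμ hL s hζ) hη
  · refine (h.div_const (L : ℝ)).congr fun t => ?_
    rw [scaledCGF, activityMGF_eq hw hμ.le, div_div, mul_comm t]
  · have hconst : L * (μ + 2 * w) * f ζ = ∑ k ∈ Finset.range L, (μ + 2 * w) * f ζ := by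
      rw [Finset.sum_const, Finset.card_range, nsmul_eq_mul, mul_assoc]
    rw [tiltedGenerator_apply, hconst, ← Finset.sum_add_distrib]
    refine Finset.sum_nonneg fun k hk => ?_
    have h0 := occ_nonneg ζ (k : ZMod L)
    have h1 := occ_nonneg ζ ((k : ZMod L) + 1)
    have h2 := occ_le_one ζ (k : ZMod L)
    have h3 := occ_le_one ζ ((k : ZMod L) + 1)
    have h4 := hf _ (isEven_flip hL (Finset.mem_range.1 hk) hζ)
    have h5 := hf ζ hζ
    have h6 : 0 ≤ (μ + w * Real.exp s * (occ ζ (k : ZMod L) + occ ζ ((k : ZMod L) + 1))) *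
      f (flip ζ (k : ZMod L)) := by positivity
    have h7 : 0 ≤ w * (2 - occ ζ (k : ZMod L) - occ ζ ((k : ZMod L) + 1)) * f ζ :=
      mul_nonneg (mul_nonneg hw (by linarith)) h5
    linarith

theorem limitingCGF_eq (hw : 0 ≤ w) (hμ : 0 < μ) (hL : 2 ≤ L) (s : ℝ) :
    limitingCGF w μ L s = topEigenvalue w μ (Real.exp s) L / L :=
  (tendsto_scaledCGF hw hμ hL (isEven_empty L) s).limUnder_eq

end JointProcess

/-! ### Sums of reciprocals of odd numbers. -/

section OddHarmonic

theorem sum_inv_odd (L : ℕ) : ∑ m ∈ Finset.range L, (1 : ℝ) / (2 * m + 1) =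
    (harmonic (2 * L) : ℝ) - (harmonic L : ℝ) / 2 := by
  induction L with
  | zero => simp
  | succ n ih =>
    rw [Finset.sum_range_succ, ih, show 2 * (n + 1) = 2 * n + 1 + 1 by ring, harmonic_succ,
      harmonic_succ, harmonic_succ]
    push_cast
    field_simp
    ring

theorem tendsto_log_natCast : Tendsto (fun L : ℕ => Real.log (L : ℝ)) atTop atTop :=
  Real.tendsto_log_atTop.comp tendsto_natCast_atTop_atTop

theorem tendsto_sum_inv_odd_div_log :
    Tendsto (fun L : ℕ => (∑ m ∈ Finset.range L, (1 : ℝ) / (2 * m + 1)) / Real.log L) atTop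
      (𝓝 (1 / 2)) := by
  have h1 := Real.tendsto_harmonic_sub_log
  have h2 : Tendsto (fun L : ℕ => (harmonic (2 * L) : ℝ) - Real.log ((2 * L : ℕ) : ℝ)) atTop
      (𝓝 Real.eulerMascheroniConstant) :=
    h1.comp (tendsto_id.const_mul_atTop' (by norm_num : 0 < 2))
  have h3 := ((h2.sub (h1.div_const 2)).add_const (Real.log 2)).div_atTop tendsto_log_natCast
  have h4 := h3.add_const (1 / 2 : ℝ)
  rw [zero_add] at h4
  refine h4.congr' ?_
  filter_upwards [eventually_ge_atTop 2] with L hL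
  have hL' : (L : ℝ) ≠ 0 := Nat.cast_ne_zero.2 (by omega)
  have hlog : Real.log (L : ℝ) ≠ 0 := (Real.log_pos (by exact_mod_cast hL)).ne'
  rw [sum_inv_odd]
  push_cast
  rw [Real.log_mul two_ne_zero hL']
  field_simp
  ring

end OddHarmonic

/-! ### Logarithmic asymptotics of sums with a `1 / sin` singularity. -/

section SingularSum

/-- Half momenta fill `(0, π)`, so both poles of `1 / sin` count, and each contributes the same odd
harmonic sum. -/
theorem abs_inv_sin_sub_le {y : ℝ} (h0 : 0 < y) (h1 : y ≤ Real.pi / 2) :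
    |1 / Real.sin y - 1 / y - 1 / (Real.pi - y)| ≤ 2 := by
  have hs := Real.mul_le_sin h0.le h1
  have hpi := Real.pi_pos
  have hpi3 := Real.pi_gt_three
  have hpi4 := Real.pi_le_four
  have hs0 : 0 < Real.sin y := lt_of_lt_of_le (by positivity) hs
  have h2 : 1 / Real.sin y - 1 / y ≤ 1 := by
    have h3 := Real.sin_gt_sub_cube h0
    rw [div_sub_div _ _ hs0.ne' h0.ne', div_le_one (by positivity)]
    have h4 : 1 / 2 * y ≤ Real.sin y := le_trans
      (mul_le_mul_of_nonneg_right (by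
        rw [div_le_div_iff₀ (by norm_num) hpi]
        linarith) h0.le) hs
    have h5 : y ≤ 2 := by linarith
    have h6 : y ^ 3 ≤ 2 * y ^ 2 := by nlinarith [sq_nonneg y]
    nlinarith [mul_le_mul_of_nonneg_right h4 h0.le]
  have h3 : 0 ≤ 1 / Real.sin y - 1 / y := by
    rw [sub_nonneg]
    exact one_div_le_one_div_of_le hs0 (Real.sin_le h0.le)
  have h4 : 1 / (Real.pi - y) ≤ 1 := by
    rw [div_le_one (by linarith)]
    linarith
  have h5 : 0 ≤ 1 / (Real.pi - y) := by
    have : 0 < Real.pi - y := by linarith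
    positivity
  rw [abs_le]
  constructor <;> linarith

theorem abs_inv_sin_sub_le' {y : ℝ} (h0 : 0 < y) (h1 : y < Real.pi) :
    |1 / Real.sin y - 1 / y - 1 / (Real.pi - y)| ≤ 2 := by
  rcases le_total y (Real.pi / 2) with h | h
  · exact abs_inv_sin_sub_le h0 h
  · have := abs_inv_sin_sub_le (y := Real.pi - y) (by linarith) (by linarith)
    rw [Real.sin_pi_sub, sub_sub_cancel] at this
    rwa [sub_right_comm]

variable {L : ℕ}

theorem half_momentum_pos (hL : L ≠ 0) (m : ℕ) : 0 < momentum L m / 2 := by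
  have := Real.pi_pos
  have : (0 : ℝ) < L := Nat.cast_pos.2 (Nat.pos_of_ne_zero hL)
  unfold momentum
  positivity

theorem half_momentum_lt {m : ℕ} (hm : m < L) : momentum L m / 2 < Real.pi := by
  have := half_momentum_pos (by omega : L ≠ 0) (L - 1 - m)
  rw [momentum_reflect hm] at this
  linarith

theorem sin_half_momentum_pos {m : ℕ} (hm : m < L) : 0 < Real.sin (momentum L m / 2) :=
  Real.sin_pos_of_pos_of_lt_pi (half_momentum_pos (by omega) m) (half_momentum_lt hm)

theorem abs_sum_inv_sin_sub_le (L : ℕ) :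
    |(∑ m ∈ Finset.range L, 1 / Real.sin (momentum L m / 2)) -
      4 * L / Real.pi * ∑ m ∈ Finset.range L, (1 : ℝ) / (2 * m + 1)| ≤ 2 * L := by
  have hpi := Real.pi_pos
  have h1 : ∑ m ∈ Finset.range L, 1 / (momentum L m / 2) =
      2 * L / Real.pi * ∑ m ∈ Finset.range L, (1 : ℝ) / (2 * m + 1) := by
    rw [Finset.mul_sum]
    refine Finset.sum_congr rfl fun m hm => ?_
    have : (L : ℝ) ≠ 0 := Nat.cast_ne_zero.2 (by
      have := Finset.mem_range.1 hm
      omega)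
    rw [momentum]
    field_simp
  have h2 : ∑ m ∈ Finset.range L, 1 / (Real.pi - momentum L m / 2) =
      2 * L / Real.pi * ∑ m ∈ Finset.range L, (1 : ℝ) / (2 * m + 1) := by
    rw [← h1]
    conv_rhs => rw [← Finset.sum_range_reflect]
    refine Finset.sum_congr rfl fun m hm => ?_
    rw [momentum_reflect (Finset.mem_range.1 hm)]
    congr 1
    ring
  have h3 : (∑ m ∈ Finset.range L, 1 / Real.sin (momentum L m / 2)) -
      4 * L / Real.pi * ∑ m ∈ Finset.range L, (1 : ℝ) / (2 * m + 1) =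
      ∑ m ∈ Finset.range L, (1 / Real.sin (momentum L m / 2) - 1 / (momentum L m / 2) -
        1 / (Real.pi - momentum L m / 2)) := by
    rw [Finset.sum_sub_distrib, Finset.sum_sub_distrib, h1, h2]
    ring
  rw [h3]
  refine (Finset.abs_sum_le_sum_abs _ _).trans ((Finset.sum_le_sum fun m hm =>
    abs_inv_sin_sub_le' (half_momentum_pos ?_ m) (half_momentum_lt (Finset.mem_range.1 hm))).trans_eq
    ?_)
  · have := Finset.mem_range.1 hm
    omega
  · rw [Finset.sum_const, Finset.card_range, nsmul_eq_mul, mul_comm]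

/-- Since `Ψ` is Lipschitz on `[0, 1]`, replacing `Ψ(σ)` by `Ψ(0)` costs a bounded amount per mode.
-/
theorem abs_sum_div_sin_sub_le {Ψ : ℝ → ℝ} (hΨ : ContDiff ℝ 1 Ψ) : ∃ K : ℝ, ∀ L : ℕ,
    |(∑ m ∈ Finset.range L, Ψ (Real.sin (momentum L m / 2)) / Real.sin (momentum L m / 2)) -
      Ψ 0 * (4 * L / Real.pi * ∑ m ∈ Finset.range L, (1 : ℝ) / (2 * m + 1))| ≤ K * L := by
  obtain ⟨K, hK⟩ := hΨ.contDiffOn.exists_lipschitzOnWith (by decide) (convex_Icc (0 : ℝ) 1)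
    isCompact_Icc
  refine ⟨K + |Ψ 0| * 2, fun L => ?_⟩
  have h1 : |∑ m ∈ Finset.range L, (Ψ (Real.sin (momentum L m / 2)) - Ψ 0) /
      Real.sin (momentum L m / 2)| ≤ K * L := by
    refine (Finset.abs_sum_le_sum_abs _ _).trans ((Finset.sum_le_sum (g := fun _ => (K : ℝ))
      fun m hm => ?_).trans_eq ?_)
    · have hpos := sin_half_momentum_pos (Finset.mem_range.1 hm)
      have := hK.dist_le_mul (Real.sin (momentum L m / 2)) ⟨hpos.le, Real.sin_le_one _⟩ 0
        ⟨le_rfl, zero_le_one⟩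
      rw [Real.dist_eq, Real.dist_eq, sub_zero, abs_of_pos hpos] at this
      rwa [abs_div, abs_of_pos hpos, div_le_iff₀ hpos]
    · rw [Finset.sum_const, Finset.card_range, nsmul_eq_mul, mul_comm]
  have h2 := mul_le_mul_of_nonneg_left (abs_sum_inv_sin_sub_le L) (abs_nonneg (Ψ 0))
  rw [← abs_mul] at h2
  have h3 : (∑ m ∈ Finset.range L, Ψ (Real.sin (momentum L m / 2)) / Real.sin (momentum L m / 2)) -
      Ψ 0 * (4 * L / Real.pi * ∑ m ∈ Finset.range L, (1 : ℝ) / (2 * m + 1)) =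
      (∑ m ∈ Finset.range L, (Ψ (Real.sin (momentum L m / 2)) - Ψ 0) /
      Real.sin (momentum L m / 2)) + Ψ 0 * ((∑ m ∈ Finset.range L,
        1 / Real.sin (momentum L m / 2)) -
      4 * L / Real.pi * ∑ m ∈ Finset.range L, (1 : ℝ) / (2 * m + 1)) := by
    rw [mul_sub, ← add_sub_assoc]
    congr 1
    rw [Finset.mul_sum, ← Finset.sum_add_distrib]
    refine Finset.sum_congr rfl fun m _ => ?_
    ring
  rw [h3]
  refine (abs_add_le _ _).trans ((add_le_add h1 h2).trans_eq ?_)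
  ring

theorem tendsto_sum_div_sin {Ψ : ℝ → ℝ} (hΨ : ContDiff ℝ 1 Ψ) :
    Tendsto (fun L : ℕ => (∑ m ∈ Finset.range L,
      Ψ (Real.sin (momentum L m / 2)) / Real.sin (momentum L m / 2)) / (2 * L) / Real.log L) atTop
      (𝓝 (Ψ 0 / Real.pi)) := by
  obtain ⟨K, hK⟩ := abs_sum_div_sin_sub_le hΨ
  have h1 := (tendsto_sum_inv_odd_div_log).const_mul (2 * Ψ 0 / Real.pi)
  rw [show 2 * Ψ 0 / Real.pi * (1 / 2) = Ψ 0 / Real.pi by ring] at h1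
  have h2 : Tendsto (fun L : ℕ => K / 2 / Real.log (L : ℝ)) atTop (𝓝 0) :=
    tendsto_const_nhds.div_atTop tendsto_log_natCast
  refine (tendsto_iff_of_dist ?_).1 h1
  refine squeeze_zero' (Eventually.of_forall fun _ => dist_nonneg) ?_ h2
  filter_upwards [eventually_ge_atTop 2] with L hL
  have hpi := Real.pi_pos
  have hL' : (0 : ℝ) < L := Nat.cast_pos.2 (by omega)
  have hlog : 0 < Real.log (L : ℝ) := Real.log_pos (by exact_mod_cast hL)
  rw [dist_comm, Real.dist_eq]
  set S := ∑ m ∈ Finset.range L, Ψ (Real.sin (momentum L m / 2)) / Real.sin (momentum L m / 2)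
  set O := ∑ m ∈ Finset.range L, (1 : ℝ) / (2 * m + 1)
  have h3 : S / (2 * L) / Real.log L - 2 * Ψ 0 / Real.pi * (O / Real.log L) =
      (S - Ψ 0 * (4 * L / Real.pi * O)) / (2 * L * Real.log L) := by
    field_simp
    ring
  rw [h3, abs_div, abs_of_pos (by positivity : 0 < 2 * L * Real.log L), div_div,
    div_le_div_iff₀ (by positivity) (by positivity)]
  have := mul_le_mul_of_nonneg_right (hK L) (by positivity : 0 ≤ 2 * Real.log L)
  linarith

end SingularSum

/-! ### Derivatives at the critical point. -/

section Cumulants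

/-- Antiperiodic momenta avoid `q = 0`, so at finite `L` the square roots stay smooth even at `s_c`.
-/
theorem modeDiscriminant_pos {w μ x : ℝ} (hw : 0 < w) (hμ : 0 < μ) (hx : 0 < x) {L : ℕ}
    (hL : L ≠ 0) (m : ℕ) : 0 < modeDiscriminant w μ x L m := by
  rcases eq_or_ne (Real.sin (momentum L m)) 0 with h | h
  · have h1 := Real.sin_sq_add_cos_sq (momentum L m)
    rw [h, zero_pow two_ne_zero, zero_add] at h1
    have hc : Real.cos (momentum L m) = -1 :=
      (mul_self_eq_one_iff.1 ((sq _).symm.trans h1)).resolve_left (cos_momentum_ne_one hL m)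
    have hA : modeDiagonal w μ x L m < 0 := by
      rw [modeDiagonal, hc]
      have : 0 < w * x := mul_pos hw hx
      linarith
    rw [modeDiscriminant, h]
    have := hA.ne
    positivity
  · unfold modeDiscriminant
    positivity

theorem modeDiscriminant_eq (ν x : ℝ) (L m : ℕ) :
    modeDiscriminant (1 / 2) ((1 - ν) / 2) x L m =
      ((1 - ν) ^ 2 + 1 - 2 * (1 - ν) * Real.cos (momentum L m)) +
        (2 * (1 - ν) - 2 * Real.cos (momentum L m)) * x + Real.cos (momentum L m) ^ 2 * x ^ 2 := by
  have h := Real.sin_sq_add_cos_sq (momentum L m)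
  rw [modeDiscriminant, modeDiagonal]
  linear_combination ((1 - ν) * (1 - ν + 2 * x)) * h

/-- The quadratic polynomial `a + b x + c x²` in `x = exp s`. -/
noncomputable def expQuadratic (a b c s : ℝ) : ℝ :=
  a + b * Real.exp s + c * Real.exp (2 * s)

theorem hasDerivAt_expQuadratic (a b c s : ℝ) :
    HasDerivAt (expQuadratic a b c) (expQuadratic 0 b (2 * c) s) s := by
  have h1 := (Real.hasDerivAt_exp s).const_mul b
  have h2 := (((hasDerivAt_id s).const_mul 2).exp).const_mul c
  refine ((h1.const_add a).add h2).congr_deriv ?_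
  simp only [expQuadratic, id, mul_one]
  ring

theorem hasDerivAt_sqrt_first {g g1 : ℝ → ℝ} {s : ℝ} (h0 : HasDerivAt g (g1 s) s)
    (hg : 0 < g s) : HasDerivAt (fun s => √(g s)) (g1 s / (2 * √(g s))) s :=
  h0.sqrt hg.ne'

theorem hasDerivAt_sqrt_second {g g1 g2 : ℝ → ℝ} {s : ℝ} (h0 : HasDerivAt g (g1 s) s)
    (h1 : HasDerivAt g1 (g2 s) s) (hg : 0 < g s) :
    HasDerivAt (fun s => g1 s / (2 * √(g s)))
      (g2 s / (2 * √(g s)) - g1 s ^ 2 / (4 * (g s * √(g s)))) s := by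
  have hr : √(g s) ≠ 0 := (Real.sqrt_pos.2 hg).ne'
  have hsq := Real.sq_sqrt hg.le
  refine (h1.div ((hasDerivAt_sqrt_first h0 hg).const_mul 2) (by positivity)).congr_deriv ?_
  field_simp
  rw [hsq]
  ring

theorem hasDerivAt_sqrt_third {g g1 g2 g3 : ℝ → ℝ} {s : ℝ} (h0 : HasDerivAt g (g1 s) s)
    (h1 : HasDerivAt g1 (g2 s) s) (h2 : HasDerivAt g2 (g3 s) s) (hg : 0 < g s) :
    HasDerivAt (fun s => g2 s / (2 * √(g s)) - g1 s ^ 2 / (4 * (g s * √(g s))))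
      (g3 s / (2 * √(g s)) - 3 * g1 s * g2 s / (4 * (g s * √(g s))) +
        3 * g1 s ^ 3 / (8 * (g s ^ 2 * √(g s)))) s := by
  have hr : √(g s) ≠ 0 := (Real.sqrt_pos.2 hg).ne'
  have hsq := Real.sq_sqrt hg.le
  have hd := hasDerivAt_sqrt_first h0 hg
  refine ((h2.div (hd.const_mul 2) (by positivity)).sub
    ((h1.pow 2).div ((h0.mul hd).const_mul 4)
      (mul_ne_zero four_ne_zero (mul_ne_zero hg.ne' hr)))).congr_deriv ?_
  simp only [Pi.mul_apply, Pi.pow_apply]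
  field_simp
  rw [hsq]
  push_cast
  ring

theorem iteratedDeriv_two_three {F F1 F2 F3 : ℝ → ℝ} (h0 : ∀ s, HasDerivAt F (F1 s) s)
    (h1 : ∀ s, HasDerivAt F1 (F2 s) s) (h2 : ∀ s, HasDerivAt F2 (F3 s) s) :
    iteratedDeriv 2 F = F2 ∧ iteratedDeriv 3 F = F3 := by
  have e0 : deriv F = F1 := funext fun s => (h0 s).deriv
  have e1 : deriv F1 = F2 := funext fun s => (h1 s).deriv
  have e2 : deriv F2 = F3 := funext fun s => (h2 s).deriv
  have i2 : iteratedDeriv 2 F = F2 := by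
    rw [iteratedDeriv_succ, iteratedDeriv_one, e0, e1]
  exact ⟨i2, by rw [iteratedDeriv_succ, i2, e2]⟩

/-- The discriminant of a mode as a function of the Legendre parameter, differentiated `k` times. -/
noncomputable def logDiscriminant (ν : ℝ) (L m k : ℕ) : ℝ → ℝ :=
  expQuadratic (if k = 0 then (1 - ν) ^ 2 + 1 - 2 * (1 - ν) * Real.cos (momentum L m) else 0)
    (2 * (1 - ν) - 2 * Real.cos (momentum L m)) (2 ^ k * Real.cos (momentum L m) ^ 2)

theorem logDiscriminant_zero (ν : ℝ) (L m : ℕ) (s : ℝ) :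
    logDiscriminant ν L m 0 s = modeDiscriminant (1 / 2) ((1 - ν) / 2) (Real.exp s) L m := by
  rw [modeDiscriminant_eq, logDiscriminant, expQuadratic, if_pos rfl, two_mul s, Real.exp_add]
  ring

theorem hasDerivAt_logDiscriminant (ν : ℝ) (L m k : ℕ) (s : ℝ) :
    HasDerivAt (logDiscriminant ν L m k) (logDiscriminant ν L m (k + 1) s) s := by
  refine (hasDerivAt_expQuadratic _ _ _ s).congr_deriv ?_
  rw [logDiscriminant, if_neg (Nat.succ_ne_zero k), pow_succ']
  ring_nf

variable {ν : ℝ}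

theorem logDiscriminant_pos (hν : ν < 1) {L : ℕ} (hL : L ≠ 0) (m : ℕ) (s : ℝ) :
    0 < logDiscriminant ν L m 0 s := by
  rw [logDiscriminant_zero]
  exact modeDiscriminant_pos (by norm_num) (by linarith) (Real.exp_pos s) hL m

theorem cgf_eq (hν : ν < 1) {L : ℕ} (hL : 2 ≤ L) :
    cgf ν L = fun s => (ν - 2) / 2 +
      (∑ m ∈ Finset.range L, √(logDiscriminant ν L m 0 s)) / (2 * L) := by
  ext s
  have hL' : (L : ℝ) ≠ 0 := Nat.cast_ne_zero.2 (by omega)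
  simp only [logDiscriminant_zero]
  rw [cgf, limitingCGF_eq (by norm_num) (by linarith) hL, topEigenvalue]
  field_simp
  ring

theorem contDiff_cgf (hν : ν < 1) {L : ℕ} (hL : 2 ≤ L) : ContDiff ℝ 3 (cgf ν L) := by
  rw [cgf_eq hν hL]
  refine contDiff_const.add (ContDiff.div_const (ContDiff.sum fun m _ => ?_) _)
  refine ContDiff.sqrt ?_ fun s => (logDiscriminant_pos hν (by omega) m s).ne'
  unfold logDiscriminant expQuadratic
  fun_prop

theorem criticalCumulant_eq (hν : ν < 1) {L : ℕ} (hL : 2 ≤ L) :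
    criticalCumulant ν 2 L = (∑ m ∈ Finset.range L,
      (logDiscriminant ν L m 2 (sCrit ν) / (2 * √(logDiscriminant ν L m 0 (sCrit ν))) -
        logDiscriminant ν L m 1 (sCrit ν) ^ 2 / (4 * (logDiscriminant ν L m 0 (sCrit ν) *
          √(logDiscriminant ν L m 0 (sCrit ν)))))) / (2 * L) ∧
    criticalCumulant ν 3 L = (∑ m ∈ Finset.range L,
      (logDiscriminant ν L m 3 (sCrit ν) / (2 * √(logDiscriminant ν L m 0 (sCrit ν))) -
        3 * logDiscriminant ν L m 1 (sCrit ν) * logDiscriminant ν L m 2 (sCrit ν) /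
          (4 * (logDiscriminant ν L m 0 (sCrit ν) * √(logDiscriminant ν L m 0 (sCrit ν)))) +
        3 * logDiscriminant ν L m 1 (sCrit ν) ^ 3 / (8 * (logDiscriminant ν L m 0 (sCrit ν) ^ 2 *
          √(logDiscriminant ν L m 0 (sCrit ν)))))) / (2 * L) := by
  have hpos := fun m s => logDiscriminant_pos hν (by omega : L ≠ 0) m s
  have hd := fun m k s => hasDerivAt_logDiscriminant ν L m k s
  have h := iteratedDeriv_two_three (F := cgf ν L)
    (fun s => by
      rw [cgf_eq hν hL]
      exact ((HasDerivAt.fun_sum fun m (_ : m ∈ Finset.range L) =>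
        hasDerivAt_sqrt_first (hd m 0 s) (hpos m s)).div_const (2 * L : ℝ)).const_add _)
    (fun s => (HasDerivAt.fun_sum fun m (_ : m ∈ Finset.range L) =>
        hasDerivAt_sqrt_second (hd m 0 s) (hd m 1 s) (hpos m s)).div_const (2 * L : ℝ))
    (fun s => (HasDerivAt.fun_sum fun m (_ : m ∈ Finset.range L) =>
        hasDerivAt_sqrt_third (hd m 0 s) (hd m 1 s) (hd m 2 s) (hpos m s)).div_const (2 * L : ℝ))
  exact ⟨congrFun h.1 _, congrFun h.2 _⟩

theorem sCrit_eq (ν : ℝ) : sCrit ν = Real.log ν := by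
  rw [sCrit]
  congr 1
  ring

/-- The coefficient of `4 σ²` in the critical discriminant. -/
noncomputable def critRho (ν σ : ℝ) : ℝ := 1 - ν ^ 2 + ν ^ 2 * σ ^ 2

/-- The coefficient of `4 ν σ²` in the first derivative of the critical discriminant. -/
noncomputable def critTheta (ν σ : ℝ) : ℝ := 1 - 2 * ν + 2 * ν * σ ^ 2

/-- The regular part of the contribution of a mode to the second critical cumulant. -/
noncomputable def critProfileTwo (ν σ : ℝ) : ℝ :=
  (2 * ν ^ 2 * (1 - 2 * σ ^ 2) ^ 2 + 4 * ν * σ ^ 2 * critTheta ν σ) / (4 * √(critRho ν σ)) -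
    ν ^ 2 * σ ^ 2 * critTheta ν σ ^ 2 / (2 * (critRho ν σ * √(critRho ν σ)))

/-- The regular part of the contribution of a mode to the third critical cumulant. -/
noncomputable def critProfileThree (ν σ : ℝ) : ℝ :=
  (6 * ν ^ 2 * (1 - 2 * σ ^ 2) ^ 2 + 4 * ν * σ ^ 2 * critTheta ν σ) / (4 * √(critRho ν σ)) -
    3 * ν * critTheta ν σ * (2 * ν ^ 2 * (1 - 2 * σ ^ 2) ^ 2 + 4 * ν * σ ^ 2 * critTheta ν σ) /
      (8 * (critRho ν σ * √(critRho ν σ))) +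
    3 * ν ^ 3 * σ ^ 2 * critTheta ν σ ^ 3 / (4 * (critRho ν σ ^ 2 * √(critRho ν σ)))

theorem critRho_pos (hν0 : 0 < ν) (hν : ν < 1) (σ : ℝ) : 0 < critRho ν σ := by
  have : 0 < 1 - ν ^ 2 := by nlinarith
  unfold critRho
  positivity

theorem contDiff_critProfileTwo (hν0 : 0 < ν) (hν : ν < 1) : ContDiff ℝ 1 (critProfileTwo ν) := by
  have hρ := critRho_pos hν0 hν
  have hr : ContDiff ℝ 1 (critRho ν) := by unfold critRho; fun_prop
  have hθ : ContDiff ℝ 1 (critTheta ν) := by unfold critTheta; fun_prop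
  have hs : ContDiff ℝ 1 fun σ => √(critRho ν σ) := hr.sqrt fun σ => (hρ σ).ne'
  have hs0 : ∀ σ, √(critRho ν σ) ≠ 0 := fun σ => (Real.sqrt_pos.2 (hρ σ)).ne'
  have hρ0 := fun σ => (hρ σ).ne'
  unfold critProfileTwo
  refine ContDiff.sub (ContDiff.div (by fun_prop) (by fun_prop) ?_)
    (ContDiff.div (by fun_prop) (by fun_prop) ?_)
  · exact fun σ => mul_ne_zero four_ne_zero (hs0 σ)
  · exact fun σ => mul_ne_zero two_ne_zero (mul_ne_zero (hρ0 σ) (hs0 σ))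

theorem contDiff_critProfileThree (hν0 : 0 < ν) (hν : ν < 1) :
    ContDiff ℝ 1 (critProfileThree ν) := by
  have hρ := critRho_pos hν0 hν
  have hr : ContDiff ℝ 1 (critRho ν) := by unfold critRho; fun_prop
  have hθ : ContDiff ℝ 1 (critTheta ν) := by unfold critTheta; fun_prop
  have hs : ContDiff ℝ 1 fun σ => √(critRho ν σ) := hr.sqrt fun σ => (hρ σ).ne'
  have hs0 : ∀ σ, √(critRho ν σ) ≠ 0 := fun σ => (Real.sqrt_pos.2 (hρ σ)).ne'
  have hρ0 := fun σ => (hρ σ).ne'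
  unfold critProfileThree
  refine ContDiff.add (ContDiff.sub (ContDiff.div (by fun_prop) (by fun_prop) ?_)
    (ContDiff.div (by fun_prop) (by fun_prop) ?_)) (ContDiff.div (by fun_prop) (by fun_prop) ?_)
  · exact fun σ => mul_ne_zero four_ne_zero (hs0 σ)
  · exact fun σ => mul_ne_zero (by norm_num) (mul_ne_zero (hρ0 σ) (hs0 σ))
  · exact fun σ => mul_ne_zero four_ne_zero (mul_ne_zero (pow_ne_zero 2 (hρ0 σ)) (hs0 σ))

theorem cos_eq_half (q : ℝ) : Real.cos q = 1 - 2 * Real.sin (q / 2) ^ 2 := by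
  have h := Real.cos_two_mul (q / 2)
  rw [mul_div_cancel₀ q two_ne_zero] at h
  have := Real.sin_sq_add_cos_sq (q / 2)
  linarith

/-- At `exp s = ν` the discriminant and its first derivative both lose their value at `q = 0`; the
factor `σ²` in each keeps the singularity of the higher derivatives at `1/σ`. -/
theorem logDiscriminant_crit (hν0 : 0 < ν) (L m : ℕ) :
    logDiscriminant ν L m 0 (sCrit ν) =
      4 * Real.sin (momentum L m / 2) ^ 2 * critRho ν (Real.sin (momentum L m / 2)) ∧
    logDiscriminant ν L m 1 (sCrit ν) =
      4 * ν * Real.sin (momentum L m / 2) ^ 2 * critTheta ν (Real.sin (momentum L m / 2)) ∧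
    logDiscriminant ν L m 2 (sCrit ν) =
      2 * ν ^ 2 * (1 - 2 * Real.sin (momentum L m / 2) ^ 2) ^ 2 +
      4 * ν * Real.sin (momentum L m / 2) ^ 2 * critTheta ν (Real.sin (momentum L m / 2)) ∧
    logDiscriminant ν L m 3 (sCrit ν) =
      6 * ν ^ 2 * (1 - 2 * Real.sin (momentum L m / 2) ^ 2) ^ 2 +
      4 * ν * Real.sin (momentum L m / 2) ^ 2 * critTheta ν (Real.sin (momentum L m / 2)) := by
  have h2 : Real.exp (2 * Real.log ν) = ν ^ 2 := by
    rw [two_mul, Real.exp_add, Real.exp_log hν0, sq]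
  simp only [logDiscriminant, expQuadratic, sCrit_eq, Real.exp_log hν0, h2, critRho, critTheta,
    cos_eq_half (momentum L m)]
  norm_num
  refine ⟨?_, ?_, ?_, ?_⟩ <;> ring

theorem criticalCumulant_eq_sum (hν0 : 0 < ν) (hν : ν < 1) {L : ℕ} (hL : 2 ≤ L) :
    criticalCumulant ν 2 L = (∑ m ∈ Finset.range L,
      critProfileTwo ν (Real.sin (momentum L m / 2)) / Real.sin (momentum L m / 2)) / (2 * L) ∧
    criticalCumulant ν 3 L = (∑ m ∈ Finset.range L,
      critProfileThree ν (Real.sin (momentum L m / 2)) / Real.sin (momentum L m / 2)) / (2 * L) := by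
  have hsqrt : ∀ σ : ℝ, 0 < σ → √(4 * σ ^ 2 * critRho ν σ) = 2 * σ * √(critRho ν σ) := by
    intro σ hσ
    rw [show 4 * σ ^ 2 = (2 * σ) ^ 2 by ring, Real.sqrt_mul (by positivity),
      Real.sqrt_sq (by positivity)]
  rw [(criticalCumulant_eq hν hL).1, (criticalCumulant_eq hν hL).2]
  constructor
  all_goals
    congr 1
    refine Finset.sum_congr rfl fun m hm => ?_
    have hσ := sin_half_momentum_pos (Finset.mem_range.1 hm)
    obtain ⟨e0, e1, e2, e3⟩ := logDiscriminant_crit hν0 L m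
    rw [e0, e1, e2]
    try rw [e3]
    rw [hsqrt _ hσ]
    set σ := Real.sin (momentum L m / 2)
    have hρ := critRho_pos hν0 hν σ
    have hr := Real.sqrt_pos.2 hρ
    simp only [critProfileTwo, critProfileThree]
    field_simp
    ring

theorem tendsto_criticalCumulant_two (hν0 : 0 < ν) (hν : ν < 1) :
    Tendsto (fun L : ℕ => criticalCumulant ν 2 L / Real.log L) atTop
      (𝓝 (ν ^ 2 / (2 * √(1 - ν ^ 2)) / Real.pi)) := by
  have h := tendsto_sum_div_sin (contDiff_critProfileTwo hν0 hν)
  have h0 : critProfileTwo ν 0 = ν ^ 2 / (2 * √(1 - ν ^ 2)) := by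
    rw [critProfileTwo, critRho, critTheta]
    norm_num
    rw [show (4 : ℝ) * √(1 - ν ^ 2) = 2 * (2 * √(1 - ν ^ 2)) by ring,
      mul_div_mul_left _ _ two_ne_zero]
  rw [h0] at h
  refine h.congr' ?_
  filter_upwards [eventually_ge_atTop 2] with L hL
  rw [(criticalCumulant_eq_sum hν0 hν hL).1]

theorem tendsto_criticalCumulant_three (hν0 : 0 < ν) (hν : ν < 1) :
    Tendsto (fun L : ℕ => criticalCumulant ν 3 L / Real.log L) atTop
      (𝓝 (3 * ν ^ 2 * (2 - ν) / (4 * ((1 - ν ^ 2) * √(1 - ν ^ 2))) / Real.pi)) := by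
  have h := tendsto_sum_div_sin (contDiff_critProfileThree hν0 hν)
  have hρ : 0 < 1 - ν ^ 2 := by nlinarith
  have hr := Real.sqrt_pos.2 hρ
  have h0 : critProfileThree ν 0 =
      3 * ν ^ 2 * (2 - ν) / (4 * ((1 - ν ^ 2) * √(1 - ν ^ 2))) := by
    rw [critProfileThree, critRho, critTheta]
    norm_num
    field_simp
    ring
  rw [h0] at h
  refine h.congr' ?_
  filter_upwards [eventually_ge_atTop 2] with L hL
  rw [(criticalCumulant_eq_sum hν0 hν hL).2]

end Cumulants
end DLPAD

/-! ### Asymptotics of the critical cumulant and skewness. -/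

theorem mainTheorem6 (ν : ℝ) (hν0 : 0 < ν) (hν1 : ν < 1) :
    -- the limiting cumulant generating function exists, is the same for all even initial
    -- configurations, and is smooth enough at the critical point
    (∀ L : ℕ, 2 ≤ L →
      (∀ (η : DLPAD.Config L) (s : ℝ), DLPAD.IsEven η →
        Tendsto (fun t : ℝ => DLPAD.scaledCGF (1 / 2) ((1 - ν) / 2) L η s t) atTop
          (𝓝 (DLPAD.cgf ν L s))) ∧
      ContDiffAt ℝ 3 (DLPAD.cgf ν L) (DLPAD.sCrit ν)) ∧
    -- the critical third cumulant
    (fun L : ℕ => DLPAD.criticalCumulant ν 3 L) ~[atTop]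
      (fun L : ℕ => 3 / 4 * (ν ^ 2 * (2 - ν) / ((1 - ν ^ 2) ^ (3 / 2 : ℝ) * Real.pi))
        * Real.log (L : ℝ)) ∧
    -- the critical skewness
    Tendsto (fun L : ℕ => DLPAD.criticalSkewness ν L) atTop (𝓝 0) ∧
    (fun L : ℕ => DLPAD.criticalSkewness ν L) ~[atTop]
      (fun L : ℕ => 3 * (2 - ν) / (ν * (1 - ν ^ 2) ^ (3 / 4 : ℝ))
        * Real.sqrt (Real.pi / (2 * Real.log (L : ℝ)))) := by
  have hpi := Real.pi_pos
  have hρ : 0 < 1 - ν ^ 2 := by nlinarith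
  have hr := Real.sqrt_pos.2 hρ
  have hν2 : 0 < 2 - ν := by linarith
  have hlogtop := DLPAD.tendsto_log_natCast
  have hlogpos : ∀ᶠ L : ℕ in atTop, 0 < Real.log (L : ℝ) := hlogtop.eventually_gt_atTop 0
  have hpow : (1 - ν ^ 2) ^ (3 / 2 : ℝ) = (1 - ν ^ 2) * √(1 - ν ^ 2) := by
    rw [show (3 / 2 : ℝ) = 1 + 1 / 2 by norm_num, Real.rpow_add hρ, Real.rpow_one,
      Real.sqrt_eq_rpow]
  have h2 := DLPAD.tendsto_criticalCumulant_two hν0 hν1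
  have h3 := DLPAD.tendsto_criticalCumulant_three hν0 hν1
  -- the skewness multiplied by the square root of the logarithm
  have hskew : Tendsto (fun L : ℕ => DLPAD.criticalSkewness ν L * √(Real.log (L : ℝ))) atTop
      (𝓝 (3 * (2 - ν) / (ν * (1 - ν ^ 2) ^ (3 / 4 : ℝ)) * √(Real.pi / 2))) := by
    have hc2 : 0 < ν ^ 2 / (2 * √(1 - ν ^ 2)) / Real.pi := by positivity
    have h := h3.div (h2.rpow_const (p := (3 / 2 : ℝ)) (Or.inl hc2.ne')) (by positivity)
    have hval : 3 * ν ^ 2 * (2 - ν) / (4 * ((1 - ν ^ 2) * √(1 - ν ^ 2))) / Real.pi /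
        (ν ^ 2 / (2 * √(1 - ν ^ 2)) / Real.pi) ^ (3 / 2 : ℝ) =
        3 * (2 - ν) / (ν * (1 - ν ^ 2) ^ (3 / 4 : ℝ)) * √(Real.pi / 2) := by
      -- With `d = (1 - ν²)^(1/4)` and `e = √(2π)` all fractional powers become integral, and the
      -- identity is rational in `ν`, `d`, `e`.
      obtain ⟨d, hd, hd4, hd3⟩ : ∃ d : ℝ, 0 < d ∧ 1 - ν ^ 2 = (d ^ 2) ^ 2 ∧
          (1 - ν ^ 2) ^ (3 / 4 : ℝ) = d ^ 3 := by
        refine ⟨(1 - ν ^ 2) ^ (1 / 4 : ℝ), by positivity, ?_, ?_⟩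
        · rw [← pow_mul, ← Real.rpow_mul_natCast hρ.le]
          norm_num
        · rw [← Real.rpow_mul_natCast hρ.le]
          norm_num
      obtain ⟨e, he, he2⟩ : ∃ e : ℝ, 0 < e ∧ Real.pi = e ^ 2 / 2 :=
        ⟨√(2 * Real.pi), by positivity, by rw [Real.sq_sqrt (by positivity)]; ring⟩
      rw [hd3, hd4, Real.sqrt_sq (by positivity), he2,
        show e ^ 2 / 2 / 2 = (e / 2) ^ 2 by ring, Real.sqrt_sq (by positivity),
        show ν ^ 2 / (2 * d ^ 2) / (e ^ 2 / 2) = (ν / (d * e)) ^ 2 by field_simp,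
        ← Real.rpow_natCast (ν / (d * e)), ← Real.rpow_mul (by positivity),
        show ((2 : ℕ) : ℝ) * (3 / 2) = (3 : ℕ) by norm_num, Real.rpow_natCast]
      field_simp
      norm_num
    rw [hval] at h
    refine h.congr' ?_
    have hpos2 : ∀ᶠ L : ℕ in atTop, 0 < DLPAD.criticalCumulant ν 2 L / Real.log L :=
      h2.eventually_const_lt hc2
    filter_upwards [hlogpos, hpos2] with L hl hk
    have hk' : 0 < DLPAD.criticalCumulant ν 2 L := by
      have := mul_pos hk hl
      rwa [div_mul_cancel₀ _ hl.ne'] at this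
    have hl32 : Real.log (L : ℝ) ^ (3 / 2 : ℝ) = Real.log L * √(Real.log L) := by
      rw [show (3 / 2 : ℝ) = 1 + 1 / 2 by norm_num, Real.rpow_add hl, Real.rpow_one,
        Real.sqrt_eq_rpow]
    have := Real.rpow_pos_of_pos hk' (3 / 2)
    have := Real.sqrt_pos.2 hl
    rw [Pi.div_apply, DLPAD.criticalSkewness, Real.div_rpow hk'.le hl.le, hl32]
    field_simp
  refine ⟨fun L hL => ⟨fun η s hη => ?_, (DLPAD.contDiff_cgf hν1 hL).contDiffAt⟩, ?_, ?_, ?_⟩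
  · rw [DLPAD.cgf, DLPAD.limitingCGF_eq (by norm_num) (by linarith) hL]
    exact DLPAD.tendsto_scaledCGF (by norm_num) (by linarith) hL hη s
  · refine isEquivalent_of_tendsto_one ?_
    have hc : 3 / 4 * (ν ^ 2 * (2 - ν) / ((1 - ν ^ 2) ^ (3 / 2 : ℝ) * Real.pi)) ≠ 0 := by
      positivity
    have h := h3.div_const (3 / 4 * (ν ^ 2 * (2 - ν) / ((1 - ν ^ 2) ^ (3 / 2 : ℝ) * Real.pi)))
    rw [show 3 * ν ^ 2 * (2 - ν) / (4 * ((1 - ν ^ 2) * √(1 - ν ^ 2))) / Real.pi =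
      3 / 4 * (ν ^ 2 * (2 - ν) / ((1 - ν ^ 2) ^ (3 / 2 : ℝ) * Real.pi)) by
        rw [hpow]
        field_simp, div_self hc] at h
    refine h.congr fun L => ?_
    rw [Pi.div_apply, div_div, mul_comm (Real.log (L : ℝ))]
  · have hs : Tendsto (fun L : ℕ => √(Real.log (L : ℝ))) atTop atTop :=
      Real.tendsto_sqrt_atTop.comp hlogtop
    refine (hskew.div_atTop hs).congr' ?_
    filter_upwards [hlogpos] with L hl
    rw [mul_div_cancel_right₀ _ (Real.sqrt_pos.2 hl).ne']
  · refine isEquivalent_of_tendsto_one ?_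
    have hc : 3 * (2 - ν) / (ν * (1 - ν ^ 2) ^ (3 / 4 : ℝ)) * √(Real.pi / 2) ≠ 0 := by positivity
    have h := hskew.div_const (3 * (2 - ν) / (ν * (1 - ν ^ 2) ^ (3 / 4 : ℝ)) * √(Real.pi / 2))
    rw [div_self hc] at h
    refine h.congr' ?_
    filter_upwards [hlogpos] with L hl
    have := Real.sqrt_pos.2 hl
    have := Real.sqrt_pos.2 hpi
    rw [Pi.div_apply, ← div_div Real.pi, Real.sqrt_div (by positivity : 0 ≤ Real.pi / 2)]
    field_simp
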